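/- Conventions. For a surface $\Sigma\subset\mathbb R^3$ without boundary, the medial axis of $\Sigma$ is the closure of the set of points of $\mathbb R^3$ with more than one nearest neighbor on $\Sigma$, and the local feature size $\mathrm{lfs}(x)$ of $x\in\Sigma$ is the distance from $x$ to the medial axis. For a finite set $S\subset\Sigma$, $\mathrm{sd}_2(x)$ is the distance from $x$ to the second closest point of $S$, divided by $\mathrm{lfs}(x)$, and $S$ is a uniform $\varepsilon$-sample of $\Sigma$ if $\varepsilon/4\le \mathrm{sd}_2(x)\le\varepsilon$ for all $x\in\Sigma$. Two points of $S$ are joined by an edge in the Delaunay triangulation of $S$ if and only if they lie on a sphere with no points of $S$ in its interior; the complexity of the triangulation is its number of edges. For $w,d>0$ let $\Sigma_{w,d}$ be the boundary of the union of the two sausages $$U+\overline{(-w,0,d+1),(w,0,d+1)}\quad\text{and}\quad U+\overline{(0,-w,-d-1),(0,w,-d-1)},$$ where $U$ is the closed unit ball centered at the origin, $\overline{a,b}$ is the segment from $a$ to $b$, and $+$ is the Minkowski sum. Lemma. For every real $E$ there are constants $C,c>0$ such that for every integer $n\ge 1$ and every real $\varepsilon$ with $C\sqrt{1/n}<\varepsilon\le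 E$ there are $w,d>0$ such that $\Sigma_{w,d}$ is a surface without boundary of class $C^{1,1}$ with exactly two connected components, and there is a uniform $\varepsilon$-sample $S$ of $\Sigma_{w,d}$ with exactly $n$ points whose Delaunay triangulation has at least $c\,n^2\varepsilon^2$ edges. Moreover, $S$ can be chosen so that at least $c\,n^2\varepsilon^2$ pairs of points of $S$ lie on a sphere with all other points of $S$ strictly outside it, so that these pairs are edges of every Delaunay triangulation of $S$ even if $S$ is not in general position. -/

import Mathlib

open scoped Pointwise Topology

/-- Euclidean three-space. -/
abbrev E3 : Type := EuclideanSpace ℝ (Fin 3)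

/-- The medial axis of `Sig`: the closure of the set of points of space that have more than
one nearest neighbour on `Sig`. -/
def medialAxis (Sig : Set E3) : Set E3 :=
  closure {x | ∃ y ∈ Sig, ∃ z ∈ Sig, y ≠ z ∧
    dist x y = Metric.infDist x Sig ∧ dist x z = Metric.infDist x Sig}

/-- The local feature size of `x`: its distance to the medial axis. -/
noncomputable def localFeatureSize (Sig : Set E3) (x : E3) : ℝ :=
  Metric.infDist x (medialAxis Sig)

/-- The distance from `x` to the second closest point of `S` (where `S` has at least two
points): the least radius `r` such that two different points of `S` lie within `r` of `x`. -/
noncomputable def secondDist (S : Finset E3) (x : E3) : ℝ :=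
  sInf {r : ℝ | ∃ p ∈ S, ∃ q ∈ S, p ≠ q ∧ dist x p ≤ r ∧ dist x q ≤ r}

/-- The second sampling density of `x`. -/
noncomputable def secondSamplingDensity (Sig : Set E3) (S : Finset E3) (x : E3) : ℝ :=
  secondDist S x / localFeatureSize Sig x

/-- `S` is a uniform `ε`-sample of the surface `Sig`. -/
def IsUniformSample (Sig : Set E3) (ε : ℝ) (S : Finset E3) : Prop :=
  (S : Set E3) ⊆ Sig ∧
    ∀ x ∈ Sig, ε / 4 ≤ secondSamplingDensity Sig S x ∧ secondSamplingDensity Sig S x ≤ ε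

/-- The graph of edges of the Delaunay triangulation of `S`: two different points of `S` are
joined if and only if they lie on a sphere with no point of `S` in its interior. -/
def delaunayGraph (S : Finset E3) : SimpleGraph S where
  Adj p q := p ≠ q ∧ ∃ (c : E3) (r : ℝ),
    dist (p : E3) c = r ∧ dist (q : E3) c = r ∧ ∀ s ∈ S, r ≤ dist s c
  symm := ⟨by
    rintro p q ⟨hne, c, r, hp, hq, hs⟩
    exact ⟨hne.symm, c, r, hq, hp, hs⟩⟩
  loopless := ⟨fun _ h => h.1 rfl⟩

/-- The Delaunay edges for which the sphere can be chosen with all other points of `S` strictly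
outside. These belong to every Delaunay triangulation of `S`, in whatever way the Delaunay
cells of points in degenerate position are triangulated. -/
def strictDelaunayGraph (S : Finset E3) : SimpleGraph S where
  Adj p q := p ≠ q ∧ ∃ (c : E3) (r : ℝ),
    dist (p : E3) c = r ∧ dist (q : E3) c = r ∧
      ∀ s ∈ S, s ≠ (p : E3) → s ≠ (q : E3) → r < dist s c
  symm := ⟨by
    rintro p q ⟨hne, c, r, hp, hq, hs⟩
    exact ⟨hne.symm, c, r, hq, hp, fun s h h1 h2 => hs s h h2 h1⟩⟩
  loopless := ⟨fun _ h => h.1 rfl⟩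

/-- A surface without boundary of class `C^{1,1}` embedded in space: near each of its points it
is the zero set of a `C¹` function with Lipschitz derivative and nonzero derivative there. -/
def IsC11Surface (Sig : Set E3) : Prop :=
  ∀ x ∈ Sig, ∃ f : E3 → ℝ, ContDiff ℝ 1 f ∧ (∃ K, LipschitzWith K (fderiv ℝ f)) ∧
    fderiv ℝ f x ≠ 0 ∧ ∀ᶠ y in 𝓝 x, (y ∈ Sig ↔ f y = 0)

/-- The sausage with axis from `a` to `b`: the closed unit ball swept along the segment. -/
def sausage (a b : E3) : Set E3 := Metric.closedBall (0 : E3) 1 + segment ℝ a b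

/-- The sausage of half-length `w` parallel to the first axis, at height `d` above the
horizontal coordinate plane. -/
def sausageX (w d : ℝ) : Set E3 := sausage !₂[-w, 0, d + 1] !₂[w, 0, d + 1]

/-- The sausage of half-length `w` parallel to the second axis, at depth `d` below the
horizontal coordinate plane. -/
def sausageY (w d : ℝ) : Set E3 := sausage !₂[0, -w, -d - 1] !₂[0, w, -d - 1]

/-- The surface bounding the two sausages. -/
def sausageSurface (w d : ℝ) : Set E3 := frontier (sausageX w d ∪ sausageY w d)

/-!
Both components of `sausageSurface w d` are isometric copies of one model surface, the `capsule` of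
points at distance one from a segment of half-length `w`. Writing `axisOffset w p` for the vector
from the projection of `p` to the segment to `p` itself, the capsule is `‖axisOffset w p‖ = 1`. The
squared norm of the offset is convex with Lipschitz gradient `2 • axisOffset w p`, which makes the
surface `C^{1,1}`; as a surface of revolution each component is connected.

If the two components are at distance at least `2`, the local feature size is `1` everywhere: the
axes belong to the medial axis, and a point closer than `1` to one component and off its axis has a
unique nearest point (`nearest_capsule_unique`). Hence a uniform `ε`-sample is just a subset whose
points are `ε / 2` apart and which meets every ball of radius `ε` around a point of the surface at
least twice. None of this depends on `d`, so the sample may be chosen on the model first, and `d`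
afterwards, as large as needed.

For large `d`, every sample point `(a, 0, d)` on the seam of the upper component forms a strict
Delaunay edge with every sample point `(0, b, -d)` on the seam of the lower one: the sphere through
both that is tangent to both seams has radius of order `d`, and it enters the two sausages only in
tiny neighbourhoods of the points of tangency (`tangent_sphere_estimate`). It therefore suffices to
find samples of the model with prescribed cardinality and with at least a constant times `n * ε`
points on the seam. Both `⌊n / 2⌋` and `⌊n / 2⌋ + 1` points on the same capsule are needed, so that
odd `n` can be split between two components of equal length.

* If `ε < 2√2`, every separated set that covers with radius `ε / 2` already covers twice with
  radius `ε` (`IsCapsuleNet.isCapsuleSample`). Start from a maximal separated set that contains a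
  row of points on the seam; a packing bound (`card_le_of_separated`) shows that it is not too
  large. To reach the exact cardinality, pull the two halves of the capsule apart. The covering
  radius changes continuously, and when it reaches `ε / 2` exactly, one point can be added
  (`IsCapsuleNet.exists_succ`). The points on the seam are kept.
* If `ε ≥ 2√2`, a single row of points along the seam, at a spacing of about `ε / 2`, is a sample
  (`isCapsuleSample_seamRow`).
-/

/-! ### Coordinates in three-space -/

theorem E3.dist_sq (p q : E3) :
    dist p q ^ 2 = (p 0 - q 0) ^ 2 + (p 1 - q 1) ^ 2 + (p 2 - q 2) ^ 2 := by
  rw [EuclideanSpace.dist_sq_eq, Fin.sum_univ_three]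
  simp only [Real.dist_eq, sq_abs]

theorem E3.norm_sq (p : E3) : ‖p‖ ^ 2 = p 0 ^ 2 + p 1 ^ 2 + p 2 ^ 2 := by
  rw [EuclideanSpace.norm_sq_eq, Fin.sum_univ_three]
  simp only [Real.norm_eq_abs, sq_abs]

theorem E3.inner_eq (p q : E3) : inner ℝ p q = p 0 * q 0 + p 1 * q 1 + p 2 * q 2 := by
  rw [PiLp.inner_apply, Fin.sum_univ_three]
  simp [mul_comm]

theorem E3.ext_coords {p q : E3} (h0 : p 0 = q 0) (h1 : p 1 = q 1) (h2 : p 2 = q 2) : p = q := by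
  ext i
  fin_cases i
  · exact h0
  · exact h1
  · exact h2

/-- A comparison of distances can be made between their squares, in coordinates. -/
theorem E3.dist_le_dist {p q p' q' : E3}
    (h : (p 0 - q 0) ^ 2 + (p 1 - q 1) ^ 2 + (p 2 - q 2) ^ 2 ≤
      (p' 0 - q' 0) ^ 2 + (p' 1 - q' 1) ^ 2 + (p' 2 - q' 2) ^ 2) :
    dist p q ≤ dist p' q' := by
  rw [← E3.dist_sq, ← E3.dist_sq] at h
  exact abs_le_of_sq_le_sq' h dist_nonneg |>.2

theorem E3.dist_le {p q : E3} {r : ℝ} (hr : 0 ≤ r)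
    (h : (p 0 - q 0) ^ 2 + (p 1 - q 1) ^ 2 + (p 2 - q 2) ^ 2 ≤ r ^ 2) : dist p q ≤ r := by
  rw [← E3.dist_sq] at h
  exact abs_le_of_sq_le_sq' h hr |>.2

theorem E3.le_dist {p q : E3} {r : ℝ}
    (h : r ^ 2 ≤ (p 0 - q 0) ^ 2 + (p 1 - q 1) ^ 2 + (p 2 - q 2) ^ 2) : r ≤ dist p q := by
  rw [← E3.dist_sq] at h
  exact abs_le_of_sq_le_sq' h dist_nonneg |>.2

/-! ### The model capsule -/

/-- The signed distance from `u` to the interval `[-w, w]`: soft thresholding. -/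
def shrink (w u : ℝ) : ℝ := u - max (-w) (min u w)

/-- The vector from the nearest point of the segment `[-w, w] × {0} × {0}` to `p`. -/
noncomputable def axisOffset (w : ℝ) (p : E3) : E3 := !₂[shrink w (p 0), p 1, p 2]

/-- The nearest point to `p` on the segment `[-w, w] × {0} × {0}`. -/
noncomputable def axisPoint (w : ℝ) (p : E3) : E3 := !₂[max (-w) (min (p 0) w), 0, 0]

/-- The model surface: the points at distance `1` from the segment `[-w, w] × {0} × {0}`. -/
def capsule (w : ℝ) : Set E3 := {p | ‖axisOffset w p‖ = 1}

@[simp] theorem axisOffset_zero (w : ℝ) (p : E3) : axisOffset w p 0 = shrink w (p 0) := rfl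
@[simp] theorem axisOffset_one (w : ℝ) (p : E3) : axisOffset w p 1 = p 1 := rfl
@[simp] theorem axisOffset_two (w : ℝ) (p : E3) : axisOffset w p 2 = p 2 := rfl
@[simp] theorem axisPoint_zero (w : ℝ) (p : E3) :
    axisPoint w p 0 = max (-w) (min (p 0) w) := rfl
@[simp] theorem axisPoint_one (w : ℝ) (p : E3) : axisPoint w p 1 = 0 := rfl
@[simp] theorem axisPoint_two (w : ℝ) (p : E3) : axisPoint w p 2 = 0 := rfl

theorem axisPoint_add_axisOffset (w : ℝ) (p : E3) : axisPoint w p + axisOffset w p = p := by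
  apply E3.ext_coords <;> simp [shrink]

theorem dist_axisPoint (w : ℝ) (p : E3) : dist p (axisPoint w p) = ‖axisOffset w p‖ := by
  rw [dist_eq_norm]
  congr 1
  rw [sub_eq_iff_eq_add']
  exact (axisPoint_add_axisOffset w p).symm

theorem mem_capsule {w : ℝ} {p : E3} :
    p ∈ capsule w ↔ shrink w (p 0) ^ 2 + p 1 ^ 2 + p 2 ^ 2 = 1 := by
  rw [capsule, Set.mem_ofPred_eq, ← sq_eq_sq₀ (norm_nonneg _) zero_le_one, E3.norm_sq]
  simp

theorem shrink_eq_zero {w u : ℝ} (h1 : -w ≤ u) (h2 : u ≤ w) : shrink w u = 0 := by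
  simp [shrink, h1, h2]

theorem shrink_of_le {w u : ℝ} (hw : 0 ≤ w) (h : w ≤ u) : shrink w u = u - w := by
  rw [shrink, min_eq_right h, max_eq_right (by linarith)]

theorem shrink_of_le_neg {w u : ℝ} (hw : 0 ≤ w) (h : u ≤ -w) : shrink w u = u + w := by
  rw [shrink, min_eq_left (by linarith), max_eq_left h]; ring

theorem neg_le_clamp (w u : ℝ) : -w ≤ max (-w) (min u w) := le_max_left _ _

theorem clamp_le {w : ℝ} (hw : 0 ≤ w) (u : ℝ) : max (-w) (min u w) ≤ w :=
  max_le (by linarith) (min_le_right _ _)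

/-- The three regimes of soft thresholding. -/
theorem shrink_cases {w : ℝ} (hw : 0 ≤ w) (u : ℝ) :
    (w < u ∧ shrink w u = u - w) ∨ (u < -w ∧ shrink w u = u + w) ∨
      (-w ≤ u ∧ u ≤ w ∧ shrink w u = 0) := by
  rcases lt_or_ge w u with h | h
  · exact Or.inl ⟨h, shrink_of_le hw h.le⟩
  · rcases lt_or_ge u (-w) with h' | h'
    · exact Or.inr (Or.inl ⟨h', shrink_of_le_neg hw h'.le⟩)
    · exact Or.inr (Or.inr ⟨h', h, shrink_eq_zero h' h⟩)

/-- The variational inequality for the nearest-point projection onto an interval. -/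
theorem shrink_mul_nonneg {w : ℝ} (hw : 0 ≤ w) (u : ℝ) {v : ℝ} (h1 : -w ≤ v) (h2 : v ≤ w) :
    0 ≤ shrink w u * (u - shrink w u - v) := by
  rcases shrink_cases hw u with ⟨h, e⟩ | ⟨h, e⟩ | ⟨h, h', e⟩ <;> rw [e] <;> nlinarith

/-- Moving along the ray from the projection of `u` to `[-w, w]` through `u` scales the offset. -/
theorem shrink_ray {w : ℝ} (hw : 0 ≤ w) (u : ℝ) {c : ℝ} (hc : 0 ≤ c) :
    shrink w (u - shrink w u + c * shrink w u) = c * shrink w u := by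
  rcases shrink_cases hw u with ⟨h, e⟩ | ⟨h, e⟩ | ⟨h, h', e⟩ <;> rw [e]
  · rw [shrink_of_le hw] <;> nlinarith
  · rw [shrink_of_le_neg hw] <;> nlinarith
  · simp [shrink_eq_zero h h']

theorem inner_axisOffset_nonneg {w : ℝ} (hw : 0 ≤ w) (p q : E3) :
    0 ≤ inner ℝ (axisOffset w p) (axisPoint w p - axisPoint w q) := by
  have := shrink_mul_nonneg hw (p 0) (neg_le_clamp w (q 0)) (clamp_le hw (q 0))
  rw [E3.inner_eq]
  simp only [axisOffset_zero, PiLp.sub_apply, axisPoint_zero, axisPoint_one, axisPoint_two]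
  simp only [shrink] at this ⊢
  linarith

/-- Distances dominate both the distance of the projections and that of the offsets. -/
theorem sq_dist_ge {w : ℝ} (hw : 0 ≤ w) (p q : E3) :
    ‖axisPoint w p - axisPoint w q‖ ^ 2 + ‖axisOffset w p - axisOffset w q‖ ^ 2 ≤ dist p q ^ 2 := by
  have h1 := inner_axisOffset_nonneg hw p q
  have h2 := inner_axisOffset_nonneg hw q p
  have e : p - q = (axisPoint w p - axisPoint w q) + (axisOffset w p - axisOffset w q) := by
    conv_lhs => rw [← axisPoint_add_axisOffset w p, ← axisPoint_add_axisOffset w q]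
    abel
  rw [dist_eq_norm, e, norm_add_sq_real, inner_sub_right, real_inner_comm,
    real_inner_comm (axisOffset w q)]
  rw [← neg_sub, inner_neg_right] at h2
  linarith

theorem dist_axisOffset_le {w : ℝ} (hw : 0 ≤ w) (p q : E3) :
    dist (axisOffset w p) (axisOffset w q) ≤ dist p q := by
  have := sq_dist_ge hw p q
  rw [dist_eq_norm (axisOffset w p)]
  exact abs_le_of_sq_le_sq' (by nlinarith [sq_nonneg ‖axisPoint w p - axisPoint w q‖])
    dist_nonneg |>.2

theorem continuous_axisOffset {w : ℝ} (hw : 0 ≤ w) : Continuous (axisOffset w) :=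
  (LipschitzWith.of_dist_le_mul (K := 1) fun p q => by
    simpa using dist_axisOffset_le hw p q).continuous

theorem axisOffset_ray {w : ℝ} (hw : 0 ≤ w) (p : E3) {c : ℝ} (hc : 0 ≤ c) :
    axisOffset w (axisPoint w p + c • axisOffset w p) = c • axisOffset w p := by
  apply E3.ext_coords
  · have e : (axisPoint w p + c • axisOffset w p) 0 =
        p 0 - shrink w (p 0) + c * shrink w (p 0) := by simp [shrink]
    rw [axisOffset_zero, e, shrink_ray hw (p 0) hc]
    rfl
  · simp
  · simp

theorem isClosed_capsule {w : ℝ} (hw : 0 ≤ w) : IsClosed (capsule w) :=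
  isClosed_eq (continuous_axisOffset hw).norm continuous_const

theorem capsule_zero_bound {w : ℝ} (hw : 0 ≤ w) {p : E3} (hp : p ∈ capsule w) :
    |p 0| ≤ w + 1 := by
  rw [mem_capsule] at hp
  rw [abs_le]
  rcases shrink_cases hw (p 0) with ⟨h, e⟩ | ⟨h, e⟩ | ⟨h, h', e⟩ <;> rw [e] at hp <;>
    constructor <;> nlinarith [sq_nonneg (p 1), sq_nonneg (p 2)]

theorem capsule_one_bound {w : ℝ} {p : E3} (hp : p ∈ capsule w) : |p 1| ≤ 1 := by
  rw [mem_capsule] at hp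
  exact abs_le_one_iff_mul_self_le_one.2 (by
    nlinarith [sq_nonneg (shrink w (p 0)), sq_nonneg (p 2)])

theorem capsule_two_bound {w : ℝ} {p : E3} (hp : p ∈ capsule w) : |p 2| ≤ 1 := by
  rw [mem_capsule] at hp
  exact abs_le_one_iff_mul_self_le_one.2 (by
    nlinarith [sq_nonneg (shrink w (p 0)), sq_nonneg (p 1)])

theorem isCompact_capsule {w : ℝ} (hw : 0 ≤ w) : IsCompact (capsule w) := by
  refine Metric.isCompact_of_isClosed_isBounded (isClosed_capsule hw) ?_
  refine (Metric.isBounded_closedBall (x := (0 : E3)) (r := w + 3)).subset fun p hp => ?_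
  rw [Metric.mem_closedBall]
  have h0 := abs_le.1 (capsule_zero_bound hw hp)
  have h1 := abs_le.1 (capsule_one_bound hp)
  have h2 := abs_le.1 (capsule_two_bound hp)
  refine E3.dist_le (by linarith) ?_
  simp only [PiLp.zero_apply]
  nlinarith

theorem e2_mem_capsule {w : ℝ} (u : ℝ) (h1 : -w ≤ u) (h2 : u ≤ w) :
    (!₂[u, 0, 1] : E3) ∈ capsule w := by
  rw [mem_capsule]; simp [shrink_eq_zero h1 h2]

theorem neg_e2_mem_capsule {w : ℝ} (u : ℝ) (h1 : -w ≤ u) (h2 : u ≤ w) :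
    (!₂[u, 0, -1] : E3) ∈ capsule w := by
  rw [mem_capsule]; simp [shrink_eq_zero h1 h2]

/-! ### The two components of the surface -/

/-- The linear isometry that exchanges the two horizontal axes and reverses the vertical one. -/
noncomputable def swapFlip : E3 ≃ₗᵢ[ℝ] E3 where
  toFun p := !₂[p 1, p 0, -p 2]
  invFun p := !₂[p 1, p 0, -p 2]
  map_add' p q := by apply E3.ext_coords <;> simp; ring
  map_smul' c p := by apply E3.ext_coords <;> simp
  left_inv p := by apply E3.ext_coords <;> simp
  right_inv p := by apply E3.ext_coords <;> simp
  norm_map' p := by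
    rw [← sq_eq_sq₀ (norm_nonneg _) (norm_nonneg _), E3.norm_sq, E3.norm_sq]
    simp; ring

/-- The placement of the model capsule around the axis of `sausageX`. -/
noncomputable def upper (d : ℝ) : E3 ≃ᵢ E3 := IsometryEquiv.addRight (!₂[0, 0, d + 1] : E3)

/-- The placement of the model capsule around the axis of `sausageY`; the points of the model with
lowest third coordinate go to those facing `sausageX`. -/
noncomputable def lower (d : ℝ) : E3 ≃ᵢ E3 :=
  swapFlip.toIsometryEquiv.trans (IsometryEquiv.addRight (!₂[0, 0, -d - 1] : E3))

theorem upper_apply (d : ℝ) (p : E3) : upper d p = !₂[p 0, p 1, p 2 + (d + 1)] := by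
  apply E3.ext_coords <;> simp [upper]

theorem lower_apply (d : ℝ) (p : E3) : lower d p = !₂[p 1, p 0, -p 2 - (d + 1)] := by
  apply E3.ext_coords <;> simp [lower, swapFlip]; ring

theorem upper_symm_apply (d : ℝ) (p : E3) :
    (upper d).symm p = !₂[p 0, p 1, p 2 - (d + 1)] := by
  rw [IsometryEquiv.symm_apply_eq, upper_apply]
  apply E3.ext_coords <;> simp

theorem lower_symm_apply (d : ℝ) (p : E3) :
    (lower d).symm p = !₂[p 1, p 0, -p 2 - (d + 1)] := by
  rw [IsometryEquiv.symm_apply_eq, lower_apply]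
  apply E3.ext_coords <;> simp

/-- A set swept by the closed unit ball along an isometric copy of `[-w, w] × {0} × {0}` is the
region where the offset has length at most one. -/
theorem mem_sausage_iff {w : ℝ} (hw : 0 ≤ w) (φ : E3 ≃ᵢ E3) (a b : E3)
    (h : segment ℝ a b = φ '' {p | -w ≤ p 0 ∧ p 0 ≤ w ∧ p 1 = 0 ∧ p 2 = 0}) (x : E3) :
    x ∈ sausage a b ↔ ‖axisOffset w (φ.symm x)‖ ≤ 1 := by
  have key : x ∈ sausage a b ↔ ∃ s ∈ segment ℝ a b, dist x s ≤ 1 := by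
    rw [sausage, Set.mem_add]
    constructor
    · rintro ⟨y, hy, s, hs, rfl⟩
      exact ⟨s, hs, by simpa [dist_eq_norm] using hy⟩
    · rintro ⟨s, hs, hd⟩
      exact ⟨x - s, by simpa [dist_eq_norm] using hd, s, hs, by simp⟩
  rw [key, h]
  constructor
  · rintro ⟨_, ⟨p, ⟨h1, h2, h3, h4⟩, rfl⟩, hd⟩
    have : dist x (φ p) = dist (φ.symm x) p := by
      rw [← φ.dist_eq (φ.symm x) p, φ.apply_symm_apply]
    rw [this] at hd
    have hr : axisOffset w p = 0 := by
      apply E3.ext_coords <;> simp [shrink_eq_zero h1 h2, h3, h4]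
    have := dist_axisOffset_le hw (φ.symm x) p
    rw [hr, dist_zero_right] at this
    exact this.trans hd
  · intro hr
    refine ⟨φ (axisPoint w (φ.symm x)), ⟨_, ⟨neg_le_clamp _ _, clamp_le hw _, rfl, rfl⟩, rfl⟩, ?_⟩
    rwa [← φ.apply_symm_apply x, φ.dist_eq, φ.apply_symm_apply, dist_axisPoint]

theorem mem_segment_axis {w : ℝ} (hw : 0 < w) (u : ℝ) :
    (-w ≤ u ∧ u ≤ w) ↔ ∃ θ ∈ Set.Icc (0 : ℝ) 1, u = -w + θ * (2 * w) := by
  constructor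
  · rintro ⟨h1, h2⟩
    refine ⟨(u + w) / (2 * w), ⟨by apply div_nonneg <;> linarith, ?_⟩, by field_simp; ring⟩
    rw [div_le_one (by linarith)]; linarith
  · rintro ⟨θ, ⟨h0, h1⟩, rfl⟩
    constructor <;> nlinarith

theorem mem_sausageX {w : ℝ} (hw : 0 < w) (d : ℝ) (x : E3) :
    x ∈ sausageX w d ↔ ‖axisOffset w ((upper d).symm x)‖ ≤ 1 := by
  refine mem_sausage_iff hw.le _ _ _ ?_ x
  rw [segment_eq_image']
  ext y
  simp only [Set.mem_image, Set.mem_ofPred_eq]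
  constructor
  · rintro ⟨θ, hθ, rfl⟩
    have := (mem_segment_axis hw _).2 ⟨θ, hθ, rfl⟩
    refine ⟨!₂[-w + θ * (2 * w), 0, 0], ⟨this.1, this.2, rfl, rfl⟩, ?_⟩
    rw [upper_apply]
    apply E3.ext_coords <;> simp <;> first | ring1 | (left; ring1)
  · rintro ⟨p, ⟨h1, h2, h3, h4⟩, rfl⟩
    obtain ⟨θ, hθ, e⟩ := (mem_segment_axis hw _).1 ⟨h1, h2⟩
    refine ⟨θ, hθ, ?_⟩
    rw [upper_apply]
    apply E3.ext_coords <;> simp [h3, h4, e] <;> first | ring1 | (left; ring1)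

theorem mem_sausageY {w : ℝ} (hw : 0 < w) (d : ℝ) (x : E3) :
    x ∈ sausageY w d ↔ ‖axisOffset w ((lower d).symm x)‖ ≤ 1 := by
  refine mem_sausage_iff hw.le _ _ _ ?_ x
  rw [segment_eq_image']
  ext y
  simp only [Set.mem_image, Set.mem_ofPred_eq]
  constructor
  · rintro ⟨θ, hθ, rfl⟩
    have := (mem_segment_axis hw _).2 ⟨θ, hθ, rfl⟩
    refine ⟨!₂[-w + θ * (2 * w), 0, 0], ⟨this.1, this.2, rfl, rfl⟩, ?_⟩
    rw [lower_apply]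
    apply E3.ext_coords <;> simp <;> first | ring1 | (left; ring1)
  · rintro ⟨p, ⟨h1, h2, h3, h4⟩, rfl⟩
    obtain ⟨θ, hθ, e⟩ := (mem_segment_axis hw _).1 ⟨h1, h2⟩
    refine ⟨θ, hθ, ?_⟩
    rw [lower_apply]
    apply E3.ext_coords <;> simp [h3, h4, e] <;> first | ring1 | (left; ring1)

theorem mem_image_capsule {w : ℝ} (φ : E3 ≃ᵢ E3) (x : E3) :
    x ∈ φ '' capsule w ↔ ‖axisOffset w (φ.symm x)‖ = 1 := by
  constructor
  · rintro ⟨p, hp, rfl⟩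
    rw [φ.symm_apply_apply]
    exact hp
  · exact fun h => ⟨φ.symm x, h, φ.apply_symm_apply x⟩

theorem axisOffset_le_third {w : ℝ} {p : E3} (h : ‖axisOffset w p‖ ≤ 1) : -1 ≤ p 2 := by
  have h1 := E3.norm_sq (axisOffset w p)
  simp only [axisOffset_zero, axisOffset_one, axisOffset_two] at h1
  have h2 : ‖axisOffset w p‖ ^ 2 ≤ 1 := by nlinarith [norm_nonneg (axisOffset w p)]
  nlinarith [sq_nonneg (p 1), sq_nonneg (shrink w (p 0))]

theorem upper_third {w d : ℝ} {x : E3} (h : ‖axisOffset w ((upper d).symm x)‖ ≤ 1) : d ≤ x 2 := by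
  have := axisOffset_le_third h
  rw [upper_symm_apply] at this
  simp at this
  linarith

theorem lower_third {w d : ℝ} {x : E3} (h : ‖axisOffset w ((lower d).symm x)‖ ≤ 1) :
    x 2 ≤ -d := by
  have := axisOffset_le_third h
  rw [lower_symm_apply] at this
  simp at this
  linarith

/-- Near a point of a placed capsule there are points with offset longer than one. -/
theorem capsule_not_mem_interior {w : ℝ} (hw : 0 ≤ w) (φ : E3 ≃ᵢ E3) {x : E3}
    (hx : ‖axisOffset w (φ.symm x)‖ = 1) : x ∉ interior {y | ‖axisOffset w (φ.symm y)‖ ≤ 1} := by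
  intro hi
  -- The curve scales the offset of `x` by `s`; the maximum keeps the factor nonnegative.
  let γ : ℝ → E3 := fun s =>
    φ (axisPoint w (φ.symm x) + max s 0 • axisOffset w (φ.symm x))
  have hγ : Continuous γ := φ.continuous.comp (by fun_prop)
  have h1 : γ 1 = x := by
    simp only [γ]
    rw [max_eq_left zero_le_one, one_smul, axisPoint_add_axisOffset, φ.apply_symm_apply]
  have hev : ∀ᶠ s in 𝓝 (1 : ℝ), γ s ∈ interior {y | ‖axisOffset w (φ.symm y)‖ ≤ 1} :=
    hγ.continuousAt.eventually (by rw [h1]; exact isOpen_interior.mem_nhds hi)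
  obtain ⟨s, hs, hs1⟩ := ((hev.filter_mono nhdsWithin_le_nhds).and
    (self_mem_nhdsWithin : Set.Ioi (1 : ℝ) ∈ 𝓝[>] 1)).exists
  have := interior_subset hs
  simp only [γ, Set.mem_ofPred_eq, φ.symm_apply_apply] at this
  rw [axisOffset_ray hw _ (le_max_right _ _), norm_smul, hx, mul_one, Real.norm_eq_abs] at this
  have h3 : s ≤ max s 0 := le_max_left _ _
  have h4 := le_abs_self (max s 0)
  have : (1:ℝ) < s := hs1
  linarith

theorem sausageSurface_eq {w d : ℝ} (hw : 0 < w) (hd : 0 < d) :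
    sausageSurface w d = upper d '' capsule w ∪ lower d '' capsule w := by
  have hX : sausageX w d = {y | ‖axisOffset w ((upper d).symm y)‖ ≤ 1} :=
    Set.ext fun x => mem_sausageX hw d x
  have hY : sausageY w d = {y | ‖axisOffset w ((lower d).symm y)‖ ≤ 1} :=
    Set.ext fun x => mem_sausageY hw d x
  have cX : Continuous fun y => ‖axisOffset w ((upper d).symm y)‖ :=
    ((continuous_axisOffset hw.le).comp (upper d).symm.continuous).norm
  have cY : Continuous fun y => ‖axisOffset w ((lower d).symm y)‖ :=
    ((continuous_axisOffset hw.le).comp (lower d).symm.continuous).norm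
  have c2 : Continuous fun y : E3 => y 2 := by fun_prop
  rw [sausageSurface, hX, hY, IsClosed.frontier_eq
    ((isClosed_le cX continuous_const).union (isClosed_le cY continuous_const))]
  ext x
  rw [Set.mem_sdiff, Set.mem_union, Set.mem_union, mem_image_capsule, mem_image_capsule]
  constructor
  · rintro ⟨h | h, hn⟩
    · left
      refine le_antisymm h (not_lt.1 fun hlt => hn ?_)
      refine mem_interior.2 ⟨_, fun y hy => Or.inl ?_,
        isOpen_lt cX continuous_const, hlt⟩
      exact le_of_lt (Set.mem_ofPred.1 hy)
    · right
      refine le_antisymm h (not_lt.1 fun hlt => hn ?_)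
      refine mem_interior.2 ⟨_, fun y hy => Or.inr ?_,
        isOpen_lt cY continuous_const, hlt⟩
      exact le_of_lt (Set.mem_ofPred.1 hy)
  · rintro (h | h)
    · refine ⟨Or.inl h.le, fun hi => capsule_not_mem_interior hw.le (upper d) h ?_⟩
      have h2 : 0 < x 2 := hd.trans_le (upper_third h.le)
      refine mem_interior.2 ⟨_, ?_, isOpen_interior.inter (isOpen_lt continuous_const c2), hi, h2⟩
      rintro y ⟨hy, hy2⟩
      rcases interior_subset hy with h' | h'
      · exact h'
      · have := lower_third h'
        have hy2' : 0 < y 2 := hy2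
        linarith
    · refine ⟨Or.inr h.le, fun hi => capsule_not_mem_interior hw.le (lower d) h ?_⟩
      have h2 : x 2 < 0 := (lower_third h.le).trans_lt (by linarith)
      refine mem_interior.2 ⟨_, ?_, isOpen_interior.inter (isOpen_lt c2 continuous_const), hi, h2⟩
      rintro y ⟨hy, hy2⟩
      rcases interior_subset hy with h' | h'
      · have := upper_third h'
        have hy2' : y 2 < 0 := hy2
        linarith
      · exact h'

/-! ### Smoothness -/

theorem axisOffset_axisPoint {w : ℝ} (hw : 0 ≤ w) (p : E3) : axisOffset w (axisPoint w p) = 0 := by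
  have := axisOffset_ray hw p le_rfl
  simpa using this

/-- The squared distance to the axis segment agrees with its linearization up to a quadratic
error: it is convex, and bounded by the squared distance to the projection of `p`. -/
theorem sq_norm_axisOffset_linearization {w : ℝ} (hw : 0 ≤ w) (p h : E3) :
    |‖axisOffset w (p + h)‖ ^ 2 - ‖axisOffset w p‖ ^ 2 - 2 * inner ℝ (axisOffset w p) h| ≤
      ‖h‖ ^ 2 := by
  have e1 : (p + h) - axisPoint w p = axisOffset w p + h := by
    nth_rw 1 [← axisPoint_add_axisOffset w p]
    abel
  have up : ‖axisOffset w (p + h)‖ ^ 2 ≤ ‖axisOffset w p + h‖ ^ 2 := by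
    have := dist_axisOffset_le hw (p + h) (axisPoint w p)
    rw [axisOffset_axisPoint hw, dist_zero_right, dist_eq_norm, e1] at this
    gcongr
  rw [norm_add_sq_real] at up
  have e2 : h = -(axisPoint w p - axisPoint w (p + h)) +
      (axisOffset w (p + h) - axisOffset w p) := by
    have h1 := axisPoint_add_axisOffset w p
    have h2 := axisPoint_add_axisOffset w (p + h)
    calc h = (p + h) - p := by abel
      _ = (axisPoint w (p + h) + axisOffset w (p + h)) - (axisPoint w p + axisOffset w p) := by
        rw [h1, h2]
      _ = _ := by abel
  have lo : inner ℝ (axisOffset w p) h ≤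
      inner ℝ (axisOffset w p) (axisOffset w (p + h)) - ‖axisOffset w p‖ ^ 2 := by
    conv_lhs => rw [e2]
    rw [inner_add_right, inner_neg_right,
      inner_sub_right _ (axisOffset w (p + h)), real_inner_self_eq_norm_sq]
    linarith [inner_axisOffset_nonneg hw p (p + h)]
  have sq := sq_nonneg ‖axisOffset w p - axisOffset w (p + h)‖
  rw [norm_sub_sq_real] at sq
  rw [abs_le]
  constructor <;> nlinarith [sq_nonneg ‖h‖]

theorem hasFDerivAt_sq_norm_axisOffset {w : ℝ} (hw : 0 ≤ w) (p : E3) :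
    HasFDerivAt (fun q => ‖axisOffset w q‖ ^ 2) ((2 : ℝ) • innerSL ℝ (axisOffset w p)) p := by
  rw [hasFDerivAt_iff_isLittleO_nhds_zero]
  refine Asymptotics.IsBigO.trans_isLittleO (g := fun h : E3 => ‖h‖ ^ 2) ?_
    (Asymptotics.isLittleO_norm_pow_id one_lt_two)
  refine Asymptotics.IsBigO.of_bound 1 (Filter.Eventually.of_forall fun h => ?_)
  have := sq_norm_axisOffset_linearization hw p h
  simpa using this

/-- If the inverse placement has constant surjective derivative `J`, the squared distance to the
placed axis is a defining function of class `C^{1,1}`. -/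
theorem exists_definingFunction {w : ℝ} (hw : 0 ≤ w) (φ : E3 ≃ᵢ E3) (J : E3 →L[ℝ] E3)
    (hφ : ∀ x, HasFDerivAt φ.symm J x) (hJ : Function.Surjective J) :
    ∃ f : E3 → ℝ, ContDiff ℝ 1 f ∧ (∃ K, LipschitzWith K (fderiv ℝ f)) ∧
      (∀ x ∈ φ '' capsule w, fderiv ℝ f x ≠ 0) ∧ ∀ y, y ∈ φ '' capsule w ↔ f y = 0 := by
  have hd : ∀ x, HasFDerivAt (fun y => ‖axisOffset w (φ.symm y)‖ ^ 2 - 1)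
      (((2 : ℝ) • innerSL ℝ (axisOffset w (φ.symm x))).comp J) x := fun x =>
    ((hasFDerivAt_sq_norm_axisOffset hw (φ.symm x)).comp x (hφ x)).sub_const 1
  have hfd : fderiv ℝ (fun y => ‖axisOffset w (φ.symm y)‖ ^ 2 - 1) =
      fun x => ((2 : ℝ) • innerSL ℝ (axisOffset w (φ.symm x))).comp J :=
    funext fun x => (hd x).fderiv
  have hL : LipschitzWith (2 * ‖J‖₊)
      (fderiv ℝ (fun y => ‖axisOffset w (φ.symm y)‖ ^ 2 - 1)) := by
    rw [hfd]
    refine LipschitzWith.of_dist_le_mul fun x y => ?_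
    rw [dist_eq_norm, ← ContinuousLinearMap.sub_comp, ← smul_sub, ← map_sub]
    refine (ContinuousLinearMap.opNorm_comp_le _ _).trans ?_
    rw [norm_smul, innerSL_apply_norm, ← dist_eq_norm]
    have := dist_axisOffset_le hw (φ.symm x) (φ.symm y)
    rw [φ.symm.dist_eq] at this
    simp only [Real.norm_ofNat, NNReal.coe_mul, NNReal.coe_ofNat, coe_nnnorm]
    nlinarith [norm_nonneg J, mul_le_mul_of_nonneg_right this (norm_nonneg J)]
  refine ⟨_, contDiff_one_iff_fderiv.2 ⟨fun x => (hd x).differentiableAt, hL.continuous⟩,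
    ⟨_, hL⟩, fun x hx h0 => ?_, fun y => ?_⟩
  · rw [mem_image_capsule] at hx
    obtain ⟨v, hv⟩ := hJ (axisOffset w (φ.symm x))
    have := congrArg (fun T : E3 →L[ℝ] ℝ => T v) ((hd x).fderiv.symm.trans h0)
    simp [hv, hx] at this
  · rw [mem_image_capsule, sub_eq_zero]
    exact (pow_eq_one_iff_of_nonneg (norm_nonneg _) two_ne_zero).symm

theorem hasFDerivAt_upper_symm (d : ℝ) (x : E3) :
    HasFDerivAt (upper d).symm (ContinuousLinearMap.id ℝ E3) x := by
  have e : ⇑(upper d).symm = fun p => p + !₂[0, 0, -(d + 1)] := by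
    funext p
    rw [upper_symm_apply]
    apply E3.ext_coords <;> simp; ring
  rw [e]
  exact (hasFDerivAt_id x).add_const _

theorem hasFDerivAt_lower_symm (d : ℝ) (x : E3) :
    HasFDerivAt (lower d).symm (swapFlip.toContinuousLinearEquiv : E3 →L[ℝ] E3) x := by
  have e : ⇑(lower d).symm = fun p => swapFlip p + !₂[0, 0, -(d + 1)] := by
    funext p
    rw [lower_symm_apply]
    apply E3.ext_coords <;> simp [swapFlip]; ring
  rw [e]
  exact (swapFlip.toContinuousLinearEquiv.hasFDerivAt).add_const _

theorem upper_image_third {w d : ℝ} {x : E3} (h : x ∈ upper d '' capsule w) : d ≤ x 2 :=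
  upper_third ((mem_image_capsule _ _).1 h).le

theorem lower_image_third {w d : ℝ} {x : E3} (h : x ∈ lower d '' capsule w) : x 2 ≤ -d :=
  lower_third ((mem_image_capsule _ _).1 h).le

theorem isC11Surface_sausageSurface {w d : ℝ} (hw : 0 < w) (hd : 0 < d) :
    IsC11Surface (sausageSurface w d) := by
  rw [sausageSurface_eq hw hd]
  have c2 : Continuous fun y : E3 => y 2 := by fun_prop
  rintro x (hx | hx)
  · obtain ⟨f, h1, h2, h3, h4⟩ := exists_definingFunction hw.le (upper d) _
      (hasFDerivAt_upper_symm d) Function.surjective_id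
    refine ⟨f, h1, h2, h3 x hx, ?_⟩
    filter_upwards [(isOpen_lt continuous_const c2).mem_nhds
      (hd.trans_le (upper_image_third hx))] with y hy
    rw [← h4]
    refine ⟨fun h => h.resolve_right fun h' => ?_, Or.inl⟩
    have := lower_image_third h'
    have hy' : 0 < y 2 := hy
    linarith
  · obtain ⟨f, h1, h2, h3, h4⟩ := exists_definingFunction hw.le (lower d) _
      (hasFDerivAt_lower_symm d) swapFlip.surjective
    refine ⟨f, h1, h2, h3 x hx, ?_⟩
    filter_upwards [(isOpen_lt c2 continuous_const).mem_nhds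
      ((lower_image_third hx).trans_lt (neg_lt_zero.2 hd))] with y hy
    rw [← h4]
    refine ⟨fun h => h.resolve_left fun h' => ?_, Or.inr⟩
    have := upper_image_third h'
    have hy' : y 2 < 0 := hy
    linarith

/-! ### Connected components -/

/-- The capsule is connected: it is a continuous image of a strip, as a surface of revolution. -/
theorem isPreconnected_capsule {w : ℝ} (hw : 0 ≤ w) : IsPreconnected (capsule w) := by
  have hs : Continuous (shrink w) := by unfold shrink; fun_prop
  -- The radius of the parallel circle at first coordinate `u` is `√(1 - shrink w u ^ 2)`.
  let F : ℝ × ℝ → E3 := fun z => !₂[z.1, √(1 - shrink w z.1 ^ 2) * Real.cos z.2,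
    √(1 - shrink w z.1 ^ 2) * Real.sin z.2]
  have hF : Continuous F := by
    have h1 : Continuous fun z : ℝ × ℝ => √(1 - shrink w z.1 ^ 2) := by fun_prop
    refine (PiLp.continuous_toLp 2 _).comp (continuous_pi fun i => ?_)
    fin_cases i
    · exact continuous_fst
    · exact h1.mul (by fun_prop)
    · exact h1.mul (by fun_prop)
  have himg : capsule w = F '' (Set.Icc (-(w + 1)) (w + 1) ×ˢ Set.univ) := by
    ext p
    constructor
    · intro hp
      have hb := abs_le.1 (capsule_zero_bound hw hp)
      rw [mem_capsule] at hp
      let z : ℂ := ⟨p 1, p 2⟩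
      refine ⟨(p 0, z.arg), ⟨hb, trivial⟩, ?_⟩
      have hz : √(1 - shrink w (p 0) ^ 2) = ‖z‖ := by
        rw [Complex.norm_def, Complex.normSq_mk]
        congr 1
        linarith
      apply E3.ext_coords
      · rfl
      · exact (congrArg (· * _) hz).trans (Complex.norm_mul_cos_arg z)
      · exact (congrArg (· * _) hz).trans (Complex.norm_mul_sin_arg z)
    · rintro ⟨⟨u, θ⟩, ⟨⟨h1, h2⟩, -⟩, rfl⟩
      have h3 : 0 ≤ 1 - shrink w u ^ 2 := by
        simp only at h1 h2
        rcases shrink_cases hw u with ⟨h, e⟩ | ⟨h, e⟩ | ⟨h, h', e⟩ <;> rw [e] <;> nlinarith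
      have h4 := Real.sq_sqrt h3
      rw [mem_capsule]
      change shrink w u ^ 2 + (√(1 - shrink w u ^ 2) * Real.cos θ) ^ 2 +
        (√(1 - shrink w u ^ 2) * Real.sin θ) ^ 2 = 1
      rw [mul_pow, mul_pow, h4]
      linear_combination (1 - shrink w u ^ 2) * Real.sin_sq_add_cos_sq θ
  rw [himg]
  exact (isPreconnected_Icc.prod isPreconnected_univ).image _ hF.continuousOn

/-- A union of two preconnected pieces separated by a continuous function has two components. -/
theorem card_connectedComponents_union {X : Type*} [TopologicalSpace X] {P Q : Set X}
    (hP : IsPreconnected P) (hQ : IsPreconnected Q) (hP0 : P.Nonempty) (hQ0 : Q.Nonempty)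
    (f : X → ℝ) (hf : Continuous f) (hfP : ∀ x ∈ P, 0 < f x) (hfQ : ∀ x ∈ Q, f x < 0) :
    Nat.card (ConnectedComponents ↥(P ∪ Q)) = 2 := by
  classical
  have hpos : ∀ x : ↥(P ∪ Q), 0 < f x ↔ (x : X) ∈ P := fun x =>
    ⟨fun h => x.2.resolve_right fun h' => absurd (hfQ _ h') h.not_gt, hfP _⟩
  have hneg : ∀ x : ↥(P ∪ Q), ¬ 0 < f x → (x : X) ∈ Q := fun x h =>
    x.2.resolve_left fun h' => h (hfP _ h')
  have hg : Continuous fun x : ↥(P ∪ Q) => decide (0 < f x) := by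
    rw [continuous_discrete_rng]
    have hop : IsOpen {x : ↥(P ∪ Q) | 0 < f x} :=
      isOpen_lt continuous_const (hf.comp continuous_subtype_val)
    have hop' : IsOpen {x : ↥(P ∪ Q) | f x < 0} :=
      isOpen_lt (hf.comp continuous_subtype_val) continuous_const
    intro b
    cases b
    · convert hop' using 1
      ext x
      simp only [Set.mem_preimage, Set.mem_singleton_iff, decide_eq_false_iff_not,
        Set.mem_ofPred_eq]
      exact ⟨fun h => hfQ _ (hneg x h), fun h => h.not_gt⟩
    · convert hop using 1
      ext x
      simp
  have hbij : Function.Bijective hg.connectedComponentsLift := by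
    constructor
    · intro a b
      obtain ⟨x, rfl⟩ := ConnectedComponents.surjective_coe a
      obtain ⟨y, rfl⟩ := ConnectedComponents.surjective_coe b
      intro h
      simp only [Continuous.connectedComponentsLift_apply_coe] at h
      rw [ConnectedComponents.coe_eq_coe']
      have hsub : ∀ T : Set X, IsPreconnected T → T ⊆ P ∪ Q → (x : X) ∈ T → (y : X) ∈ T →
          x ∈ connectedComponent y := by
        intro T hT hTs hx hy
        have : IsPreconnected ((Subtype.val : ↥(P ∪ Q) → X) ⁻¹' T) := by
          rw [← Topology.IsInducing.subtypeVal.isPreconnected_image, Subtype.image_preimage_coe,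
            Set.inter_eq_right.2 hTs]
          exact hT
        exact this.subset_connectedComponent hy hx
      by_cases hx : 0 < f x
      · have hy : 0 < f y := by simpa [hx] using h.symm
        exact hsub P hP Set.subset_union_left ((hpos x).1 hx) ((hpos y).1 hy)
      · have hy : ¬ 0 < f y := by simpa [hx] using h.symm
        exact hsub Q hQ Set.subset_union_right (hneg x hx) (hneg y hy)
    · intro b
      cases b
      · obtain ⟨q, hq⟩ := hQ0
        refine ⟨ConnectedComponents.mk ⟨q, Or.inr hq⟩, ?_⟩
        simpa using (hfQ q hq).le
      · obtain ⟨p, hp⟩ := hP0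
        refine ⟨ConnectedComponents.mk ⟨p, Or.inl hp⟩, ?_⟩
        simpa using hfP p hp
  rw [Nat.card_congr (Equiv.ofBijective _ hbij)]
  simp

theorem card_components_sausageSurface {w d : ℝ} (hw : 0 < w) (hd : 0 < d) :
    Nat.card (ConnectedComponents (sausageSurface w d)) = 2 := by
  rw [sausageSurface_eq hw hd]
  have hK : (capsule w).Nonempty := ⟨_, e2_mem_capsule 0 (by linarith) hw.le⟩
  exact card_connectedComponents_union
    ((isPreconnected_capsule hw.le).image _ (upper d).continuous.continuousOn)
    ((isPreconnected_capsule hw.le).image _ (lower d).continuous.continuousOn)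
    (hK.image _) (hK.image _) (fun y => y 2) (by fun_prop)
    (fun x hx => hd.trans_le (upper_image_third hx))
    (fun x hx => (lower_image_third hx).trans_lt (neg_lt_zero.2 hd))

/-! ### The local feature size -/

/-- A point off the axis has at most one nearest point on the capsule: the projection to the axis
and the direction of the offset of a nearest point are forced. -/
theorem nearest_capsule_unique {w : ℝ} (hw : 0 ≤ w) {m y : E3} (hy : y ∈ capsule w)
    (hm : axisOffset w m ≠ 0) (hmin : ∀ k ∈ capsule w, dist m y ≤ dist m k) :
    y = axisPoint w m + ‖axisOffset w m‖⁻¹ • axisOffset w m := by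
  have hρ : 0 < ‖axisOffset w m‖ := norm_pos_iff.2 hm
  have hy1 : ‖axisOffset w y‖ = 1 := hy
  have hk : axisPoint w m + ‖axisOffset w m‖⁻¹ • axisOffset w m ∈ capsule w := by
    rw [capsule, Set.mem_ofPred_eq, axisOffset_ray hw _ (inv_nonneg.2 hρ.le), norm_smul, norm_inv,
      norm_norm, inv_mul_cancel₀ hρ.ne']
  have hd : dist m (axisPoint w m + ‖axisOffset w m‖⁻¹ • axisOffset w m) ^ 2 =
      (‖axisOffset w m‖ - 1) ^ 2 := by
    have : m - (axisPoint w m + ‖axisOffset w m‖⁻¹ • axisOffset w m) =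
        (1 - ‖axisOffset w m‖⁻¹) • axisOffset w m := by
      nth_rw 1 [← axisPoint_add_axisOffset w m]
      rw [sub_smul, one_smul]
      abel
    rw [dist_eq_norm, this, norm_smul, mul_pow, Real.norm_eq_abs, sq_abs, ← mul_pow]
    congr 1
    field_simp
  have h1 := sq_dist_ge hw m y
  have h2 : dist m y ^ 2 ≤ (‖axisOffset w m‖ - 1) ^ 2 := by
    rw [← hd]
    exact pow_le_pow_left₀ dist_nonneg (hmin _ hk) 2
  have h3 := norm_sub_sq_real (axisOffset w m) (axisOffset w y)
  have h4 := real_inner_le_norm (axisOffset w m) (axisOffset w y)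
  rw [hy1] at h3 h4
  have h5 : inner ℝ (axisOffset w m) (axisOffset w y) =
      ‖axisOffset w m‖ * ‖axisOffset w y‖ := by
    rw [hy1]
    nlinarith [sq_nonneg ‖axisPoint w m - axisPoint w y‖]
  have h6 : ‖axisPoint w m - axisPoint w y‖ = 0 := by
    rw [hy1] at h5
    have : ‖axisPoint w m - axisPoint w y‖ ^ 2 ≤ 0 := by nlinarith
    exact pow_eq_zero_iff two_ne_zero |>.1 (le_antisymm this (sq_nonneg _))
  rw [inner_eq_norm_mul_iff_real, hy1, one_smul] at h5
  rw [norm_eq_zero, sub_eq_zero] at h6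
  rw [h6, (inv_smul_eq_iff₀ hρ.ne').2 h5, axisPoint_add_axisOffset]

theorem one_le_dist_axis {w : ℝ} (hw : 0 ≤ w) {m y : E3} (hy : y ∈ capsule w)
    (hm : axisOffset w m = 0) : 1 ≤ dist m y := by
  have := dist_axisOffset_le hw m y
  rw [hm, dist_zero_left] at this
  have hy1 : ‖axisOffset w y‖ = 1 := hy
  linarith

/-- If two placed capsules are at distance at least `2`, every point of the first has local feature
size `1`: its distance to its own axis. -/
theorem localFeatureSize_eq_one {w : ℝ} (hw : 0 ≤ w) (φ ψ : E3 ≃ᵢ E3)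
    (hsep : ∀ p ∈ capsule w, ∀ q ∈ capsule w, 2 ≤ dist (φ p) (ψ q)) {p : E3}
    (hp : p ∈ capsule w) :
    localFeatureSize (φ '' capsule w ∪ ψ '' capsule w) (φ p) = 1 := by
  set Sig := φ '' capsule w ∪ ψ '' capsule w with hSig
  have hc1 := neg_le_clamp w (p 0)
  have hc2 := clamp_le hw (p 0)
  -- The two points straight above and below the projection to the axis are both nearest to it.
  have hmed : φ (axisPoint w p) ∈ {x | ∃ y ∈ Sig, ∃ z ∈ Sig, y ≠ z ∧
      dist x y = Metric.infDist x Sig ∧ dist x z = Metric.infDist x Sig} := by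
    have hup := e2_mem_capsule _ hc1 hc2
    have hdown := neg_e2_mem_capsule _ hc1 hc2
    have dup : dist (axisPoint w p) !₂[max (-w) (min (p 0) w), 0, 1] = 1 := by
      rw [← sq_eq_sq₀ dist_nonneg zero_le_one, E3.dist_sq]; simp
    have ddown : dist (axisPoint w p) !₂[max (-w) (min (p 0) w), 0, -1] = 1 := by
      rw [← sq_eq_sq₀ dist_nonneg zero_le_one, E3.dist_sq]; simp
    have hinf : Metric.infDist (φ (axisPoint w p)) Sig = 1 := by
      apply le_antisymm
      · rw [← dup, ← φ.dist_eq]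
        exact Metric.infDist_le_dist_of_mem (Or.inl ⟨_, hup, rfl⟩)
      · have hne : Sig.Nonempty := ⟨_, Or.inl ⟨_, hup, rfl⟩⟩
        rw [Metric.le_infDist hne]
        rintro _ (⟨q, hq, rfl⟩ | ⟨q, hq, rfl⟩)
        · rw [φ.dist_eq]
          exact one_le_dist_axis hw hq (axisOffset_axisPoint hw p)
        · have h1 := hsep _ hup q hq
          have h2 := dist_triangle_left (φ !₂[max (-w) (min (p 0) w), 0, 1]) (ψ q)
            (φ (axisPoint w p))
          rw [φ.dist_eq, dup] at h2
          linarith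
    refine ⟨_, Or.inl ⟨_, hup, rfl⟩, _, Or.inl ⟨_, hdown, rfl⟩, fun h => ?_, ?_, ?_⟩
    · have : (1 : ℝ) = -1 := congrArg (fun v : E3 => v 2) (φ.injective h)
      norm_num at this
    · rw [hinf, φ.dist_eq, dup]
    · rw [hinf, φ.dist_eq, ddown]
  rw [localFeatureSize, medialAxis, Metric.infDist_closure]
  apply le_antisymm
  · refine (Metric.infDist_le_dist_of_mem hmed).trans ?_
    rw [φ.dist_eq, dist_axisPoint]
    exact le_of_eq hp
  · rw [Metric.le_infDist ⟨_, hmed⟩]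
    rintro m ⟨y, hy, z, hz, hne, hmy, hmz⟩
    by_contra! hlt
    -- A nearest point of `m` is less than `2` away from `φ p`, so it lies on the same capsule.
    have hpS : φ p ∈ Sig := Or.inl ⟨p, hp, rfl⟩
    have hclose : ∀ y ∈ Sig, dist m y = Metric.infDist m Sig → y ∈ φ '' capsule w := by
      rintro y hy hmy
      refine hy.resolve_right ?_
      rintro ⟨q, hq, rfl⟩
      have h1 := hsep p hp q hq
      have h2 := Metric.infDist_le_dist_of_mem (x := m) hpS
      have h3 := dist_triangle (φ p) m (ψ q)
      rw [dist_comm m] at h2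
      linarith
    obtain ⟨y', hy', rfl⟩ := hclose y hy hmy
    obtain ⟨z', hz', rfl⟩ := hclose z hz hmz
    obtain ⟨m', rfl⟩ := φ.surjective m
    rw [φ.dist_eq] at hlt hmy hmz
    by_cases h0 : axisOffset w m' = 0
    · have := one_le_dist_axis hw hp h0
      rw [dist_comm] at this
      linarith
    · have hmin : ∀ k ∈ capsule w, Metric.infDist (φ m') Sig ≤ dist m' k := fun k hk => by
        rw [← φ.dist_eq]
        exact Metric.infDist_le_dist_of_mem (Or.inl ⟨k, hk, rfl⟩)
      apply hne
      rw [nearest_capsule_unique hw hy' h0 fun k hk => hmy.trans_le (hmin k hk),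
        nearest_capsule_unique hw hz' h0 fun k hk => hmz.trans_le (hmin k hk)]

/-! ### From samples of the model capsule to samples of the surface -/

/-- A uniform `ε`-sample of the model capsule at local feature size one, in terms of distances:
its points are `ε / 2` apart, and every point of the capsule has two of them within `ε`. -/
def IsCapsuleSample (w ε : ℝ) (S : Finset E3) : Prop :=
  (∀ p ∈ S, p ∈ capsule w) ∧ (∀ p ∈ S, ∀ q ∈ S, p ≠ q → ε / 2 ≤ dist p q) ∧
    ∀ x ∈ capsule w, ∃ p ∈ S, ∃ q ∈ S, p ≠ q ∧ dist x p ≤ ε ∧ dist x q ≤ ε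

open Classical in
/-- The points of `S` on the seam of the capsule: the line along which the third coordinate takes
its least value `-1`. The placements turn the seams of the two components towards each other. -/
noncomputable def seam (S : Finset E3) : Finset E3 := S.filter fun p => p 2 = -1

theorem mem_seam {S : Finset E3} {p : E3} : p ∈ seam S ↔ p ∈ S ∧ p 2 = -1 := by
  classical
  simp [seam]

theorem seam_coords {w : ℝ} (hw : 0 ≤ w) {p : E3} (hp : p ∈ capsule w) (h2 : p 2 = -1) :
    p 1 = 0 ∧ p 0 ^ 2 ≤ w ^ 2 := by
  rw [mem_capsule, h2] at hp
  have h1 : p 1 = 0 := by nlinarith [sq_nonneg (shrink w (p 0)), sq_nonneg (p 1)]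
  have h0 : shrink w (p 0) = 0 := by nlinarith [sq_nonneg (shrink w (p 0)), sq_nonneg (p 1)]
  refine ⟨h1, ?_⟩
  rcases shrink_cases hw (p 0) with ⟨h, e⟩ | ⟨h, e⟩ | ⟨h, h', e⟩
  · linarith
  · linarith
  · nlinarith

theorem secondDist_le {S : Finset E3} {x p q : E3} {r : ℝ} (hp : p ∈ S) (hq : q ∈ S)
    (hpq : p ≠ q) (h1 : dist x p ≤ r) (h2 : dist x q ≤ r) : secondDist S x ≤ r :=
  csInf_le ⟨0, fun _ ⟨_, _, _, _, _, h, _⟩ => dist_nonneg.trans h⟩ ⟨p, hp, q, hq, hpq, h1, h2⟩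

theorem le_secondDist {S : Finset E3} {x : E3} {r : ℝ}
    (hne : ∃ p ∈ S, ∃ q ∈ S, p ≠ q)
    (hsep : ∀ p ∈ S, ∀ q ∈ S, p ≠ q → 2 * r ≤ dist p q) : r ≤ secondDist S x := by
  obtain ⟨p, hp, q, hq, hpq⟩ := hne
  refine le_csInf ⟨max (dist x p) (dist x q), p, hp, q, hq, hpq, le_max_left _ _,
    le_max_right _ _⟩ ?_
  rintro s ⟨p, hp, q, hq, hpq, h1, h2⟩
  have := hsep p hp q hq hpq
  have := dist_triangle_left p q x
  linarith

theorem two_mul_le_dist_upper_lower {w d : ℝ} {p q : E3} (hp : p ∈ capsule w)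
    (hq : q ∈ capsule w) (hd : 0 ≤ d) : 2 * d ≤ dist (upper d p) (lower d q) := by
  have h1 := upper_image_third (d := d) ⟨p, hp, rfl⟩
  have h2 := lower_image_third (d := d) ⟨q, hq, rfl⟩
  refine E3.le_dist ?_
  nlinarith [sq_nonneg (upper d p 0 - lower d q 0), sq_nonneg (upper d p 1 - lower d q 1)]

theorem localFeatureSize_upper {w d : ℝ} (hw : 0 < w) (hd : 1 ≤ d) {p : E3}
    (hp : p ∈ capsule w) : localFeatureSize (sausageSurface w d) (upper d p) = 1 := by
  rw [sausageSurface_eq hw (by linarith)]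
  exact localFeatureSize_eq_one hw.le _ _ (fun p hp q hq => by
    linarith [two_mul_le_dist_upper_lower (d := d) hp hq (by linarith)]) hp

theorem localFeatureSize_lower {w d : ℝ} (hw : 0 < w) (hd : 1 ≤ d) {p : E3}
    (hp : p ∈ capsule w) : localFeatureSize (sausageSurface w d) (lower d p) = 1 := by
  rw [sausageSurface_eq hw (by linarith), Set.union_comm]
  exact localFeatureSize_eq_one hw.le _ _ (fun p hp q hq => by
    rw [dist_comm]
    linarith [two_mul_le_dist_upper_lower (d := d) hq hp (by linarith)]) hp

open Classical in
/-- The union of a sample of the upper and one of the lower component. -/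
noncomputable def placedSample (d : ℝ) (SA SB : Finset E3) : Finset E3 :=
  SA.image (upper d) ∪ SB.image (lower d)

theorem mem_placedSample {d : ℝ} {SA SB : Finset E3} {x : E3} :
    x ∈ placedSample d SA SB ↔ (∃ p ∈ SA, upper d p = x) ∨ ∃ q ∈ SB, lower d q = x := by
  simp [placedSample]

theorem upper_ne_lower {w d : ℝ} (hd : 0 < d) {p q : E3} (hp : p ∈ capsule w)
    (hq : q ∈ capsule w) : upper d p ≠ lower d q := fun h => by
  have := two_mul_le_dist_upper_lower (d := d) hp hq hd.le
  rw [h, dist_self] at this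
  linarith

theorem card_placedSample {w d ε : ℝ} (hd : 0 < d) {SA SB : Finset E3}
    (hA : IsCapsuleSample w ε SA) (hB : IsCapsuleSample w ε SB) :
    (placedSample d SA SB).card = SA.card + SB.card := by
  rw [placedSample, Finset.card_union_of_disjoint,
    Finset.card_image_of_injective _ (upper d).injective,
    Finset.card_image_of_injective _ (lower d).injective]
  rw [Finset.disjoint_left]
  intro x hx hy
  obtain ⟨p, hp, rfl⟩ := Finset.mem_image.1 hx
  obtain ⟨q, hq, h⟩ := Finset.mem_image.1 hy
  exact upper_ne_lower hd (hA.1 p hp) (hB.1 q hq) h.symm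

theorem isUniformSample_placedSample {w d ε : ℝ} (hw : 0 < w) (hd : 1 ≤ d) (hdε : ε ≤ d)
    {SA SB : Finset E3} (hA : IsCapsuleSample w ε SA) (hB : IsCapsuleSample w ε SB) :
    IsUniformSample (sausageSurface w d) ε (placedSample d SA SB) := by
  have hd0 : 0 < d := by linarith
  have hmA : ∀ p ∈ SA, upper d p ∈ placedSample d SA SB := fun p hp =>
    mem_placedSample.2 (Or.inl ⟨p, hp, rfl⟩)
  have hmB : ∀ p ∈ SB, lower d p ∈ placedSample d SA SB := fun p hp =>
    mem_placedSample.2 (Or.inr ⟨p, hp, rfl⟩)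
  have hsep : ∀ p ∈ placedSample d SA SB, ∀ q ∈ placedSample d SA SB, p ≠ q →
      2 * (ε / 4) ≤ dist p q := by
    intro p hpS q hqS hne
    rcases mem_placedSample.1 hpS with ⟨p, hp, rfl⟩ | ⟨p, hp, rfl⟩ <;>
      rcases mem_placedSample.1 hqS with ⟨q, hq, rfl⟩ | ⟨q, hq, rfl⟩
    · rw [(upper d).dist_eq]
      linarith [hA.2.1 p hp q hq fun h => hne (congrArg _ h)]
    · linarith [two_mul_le_dist_upper_lower (d := d) (hA.1 p hp) (hB.1 q hq) hd0.le]
    · rw [dist_comm]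
      linarith [two_mul_le_dist_upper_lower (d := d) (hA.1 q hq) (hB.1 p hp) hd0.le]
    · rw [(lower d).dist_eq]
      linarith [hB.2.1 p hp q hq fun h => hne (congrArg _ h)]
  refine ⟨fun x hx => ?_, fun x hx => ?_⟩
  · rw [sausageSurface_eq hw hd0]
    rcases mem_placedSample.1 hx with ⟨p, hp, rfl⟩ | ⟨p, hp, rfl⟩
    · exact Or.inl ⟨p, hA.1 p hp, rfl⟩
    · exact Or.inr ⟨p, hB.1 p hp, rfl⟩
  · rw [sausageSurface_eq hw hd0] at hx
    rcases hx with ⟨x, hx, rfl⟩ | ⟨x, hx, rfl⟩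
    · rw [secondSamplingDensity, localFeatureSize_upper hw hd hx, div_one]
      obtain ⟨p, hp, q, hq, hne, h1, h2⟩ := hA.2.2 x hx
      have hne' : upper d p ≠ upper d q := (upper d).injective.ne hne
      refine ⟨le_secondDist ⟨_, hmA p hp, _, hmA q hq, hne'⟩ hsep,
        secondDist_le (hmA p hp) (hmA q hq) hne' ?_ ?_⟩
      · rwa [(upper d).dist_eq]
      · rwa [(upper d).dist_eq]
    · rw [secondSamplingDensity, localFeatureSize_lower hw hd hx, div_one]
      obtain ⟨p, hp, q, hq, hne, h1, h2⟩ := hB.2.2 x hx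
      have hne' : lower d p ≠ lower d q := (lower d).injective.ne hne
      refine ⟨le_secondDist ⟨_, hmB p hp, _, hmB q hq, hne'⟩ hsep,
        secondDist_le (hmB p hp) (hmB q hq) hne' ?_ ?_⟩
      · rwa [(lower d).dist_eq]
      · rwa [(lower d).dist_eq]

/-! ### Delaunay edges between the seams -/

/-- A sphere tangent to the seam at height `0`, with centre at height `D` and at lateral distance
`b` from it, leaves out a point `(x, y, η)` of the capsule that is at distance at least `ε / 2` from
the point `(a, 0, 0)` of tangency: the sphere can enter the
capsule only where `D y ^ 2 < 2 b y`, which is too close to `(a, 0, 0)`. -/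
theorem tangent_sphere_estimate {x y η a b D ε : ℝ} (hε : 0 < ε)
    (hsep : ε ^ 2 / 4 ≤ (x - a) ^ 2 + y ^ 2 + η ^ 2) (hy : y ^ 2 ≤ 2 * η)
    (hD : 4 * b ^ 2 < D * ε ^ 2) :
    b ^ 2 + D ^ 2 < (x - a) ^ 2 + (y - b) ^ 2 + (η + D) ^ 2 := by
  have hε2 : 0 < ε ^ 2 := by positivity
  have hD0 : 0 < D := by
    by_contra! h
    nlinarith [sq_nonneg b]
  -- Completing the square leaves the remainder `D * ε ^ 2 / 4 - b ^ 2`.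
  have h1 : 0 < D * (ε ^ 2 / 4 - 2 * b * y + D * y ^ 2) := by
    nlinarith [sq_nonneg (D * y - b)]
  have h2 := pos_of_mul_pos_right h1 hD0.le
  nlinarith [mul_le_mul_of_nonneg_left hy hD0.le]

theorem capsule_sq_le {w : ℝ} {p : E3} (hp : p ∈ capsule w) : p 1 ^ 2 ≤ 2 * (p 2 + 1) := by
  rw [mem_capsule] at hp
  nlinarith [sq_nonneg (shrink w (p 0)), sq_nonneg (p 2 + 1)]

/-- The strict Delaunay edges join every seam point of one component to every seam point of the
other, once the components are far apart. The sphere is tangent to both seams, so its centre is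
`(a, b, z)` when the points are `(a, 0, d)` and `(0, b, -d)`. -/
theorem strictDelaunay_adj_seam {w d ε : ℝ} (hw : 0 < w) (hε : 0 < ε)
    (hd : w + ε + 2 + 4 * w ^ 2 / ε ^ 2 ≤ d) {SA SB : Finset E3}
    (hA : IsCapsuleSample w ε SA) (hB : IsCapsuleSample w ε SB) {p q : E3} (hp : p ∈ seam SA)
    (hq : q ∈ seam SB) (hpS : upper d p ∈ placedSample d SA SB)
    (hqS : lower d q ∈ placedSample d SA SB) :
    (strictDelaunayGraph (placedSample d SA SB)).Adj ⟨_, hpS⟩ ⟨_, hqS⟩ := by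
  rw [mem_seam] at hp hq
  obtain ⟨hpA, hp2⟩ := hp
  obtain ⟨hqB, hq2⟩ := hq
  obtain ⟨hp1, hp0⟩ := seam_coords hw.le (hA.1 p hpA) hp2
  obtain ⟨hq1, hq0⟩ := seam_coords hw.le (hB.1 q hqB) hq2
  have hε2 : 0 < ε ^ 2 := by positivity
  have hquot : 0 ≤ 4 * w ^ 2 / ε ^ 2 := by positivity
  have hd0 : 0 < d := by linarith
  set a := p 0 with ha
  set b := q 0 with hb
  -- This height makes `(a, b, z)` equidistant from `(a, 0, d)` and `(0, b, -d)`.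
  obtain ⟨z, hz⟩ : ∃ z : ℝ, 4 * d * z = b ^ 2 - a ^ 2 :=
    ⟨(b ^ 2 - a ^ 2) / (4 * d), by field_simp⟩
  have hw2 : w ^ 2 ≤ d * w := by nlinarith
  have hz1 : z ≤ w := by
    by_contra! h
    nlinarith [sq_nonneg a, mul_lt_mul_of_pos_left h hd0]
  have hz2 : -w ≤ z := by
    by_contra! h
    nlinarith [sq_nonneg b, mul_lt_mul_of_pos_left h hd0]
  have hbig : ∀ D, d - w ≤ D → 4 * w ^ 2 < D * ε ^ 2 := by
    intro D hD
    have h1 : 4 * w ^ 2 / ε ^ 2 < D := by linarith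
    rwa [div_lt_iff₀ hε2] at h1
  have hDb : 4 * b ^ 2 < (d - z) * ε ^ 2 := by
    have := hbig (d - z) (by linarith)
    linarith
  have hDa : 4 * a ^ 2 < (d + z) * ε ^ 2 := by
    have := hbig (d + z) (by linarith)
    linarith
  have hsepε : ∀ S, IsCapsuleSample w ε S → ∀ s ∈ S, ∀ t ∈ S, s ≠ t →
      ε ^ 2 / 4 ≤ (s 0 - t 0) ^ 2 + (s 1 - t 1) ^ 2 + (s 2 - t 2) ^ 2 := by
    intro S hS s hs t ht hne
    rw [← E3.dist_sq]
    have := hS.2.1 s hs t ht hne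
    nlinarith
  let c : E3 := !₂[a, b, z]
  have hpc : dist (upper d p) c ^ 2 = b ^ 2 + (d - z) ^ 2 := by
    rw [E3.dist_sq, upper_apply]
    simp [c, ← ha, hp1, hp2]
  have hqc : dist (lower d q) c ^ 2 = a ^ 2 + (d + z) ^ 2 := by
    rw [E3.dist_sq, lower_apply]
    simp [c, ← hb, hq1, hq2]
    ring
  refine ⟨fun h => upper_ne_lower hd0 (hA.1 p hpA) (hB.1 q hqB) (congrArg Subtype.val h),
    c, dist (upper d p) c, rfl, ?_, ?_⟩
  · change dist (lower d q) c = _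
    rw [← sq_eq_sq₀ dist_nonneg dist_nonneg, hpc, hqc]
    linarith
  · intro s hsS hsp hsq
    refine lt_of_pow_lt_pow_left₀ 2 dist_nonneg ?_
    rcases mem_placedSample.1 hsS with ⟨s, hs, rfl⟩ | ⟨s, hs, rfl⟩
    · have h1 := hsepε SA hA s hs p hpA fun h => hsp (congrArg _ h)
      rw [← ha, hp1, hp2, sub_zero, sub_neg_eq_add] at h1
      have h2 := tangent_sphere_estimate hε h1 (capsule_sq_le (hA.1 s hs)) hDb
      rw [hpc, E3.dist_sq, upper_apply]
      simp only [c, Matrix.cons_val]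
      nlinarith
    · have h1 := hsepε SB hB s hs q hqB fun h => hsq (congrArg _ h)
      rw [← hb, hq1, hq2, sub_zero, sub_neg_eq_add] at h1
      have h2 := tangent_sphere_estimate hε h1 (capsule_sq_le (hB.1 s hs)) hDa
      have h3 : dist (upper d p) c ^ 2 = a ^ 2 + (d + z) ^ 2 := by rw [hpc]; linarith
      rw [h3, E3.dist_sq, lower_apply]
      simp only [c, Matrix.cons_val]
      nlinarith

/-- A complete bipartite subgraph bounds the number of edges from below. -/
theorem card_mul_card_le_card_edgeSet {V α β : Type*} [Finite V] (G : SimpleGraph V) {f : α → V}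
    {g : β → V} (hf : Function.Injective f) (hg : Function.Injective g)
    (hadj : ∀ a b, G.Adj (f a) (g b)) (hne : ∀ a b, f a ≠ g b) :
    Nat.card α * Nat.card β ≤ Nat.card G.edgeSet := by
  rw [← Nat.card_prod]
  refine Nat.card_le_card_of_injective
    (fun x : α × β => (⟨s(f x.1, g x.2), hadj x.1 x.2⟩ : G.edgeSet)) ?_
  rintro ⟨a, b⟩ ⟨a', b'⟩ h
  have h := congrArg Subtype.val h
  simp only [Sym2.eq_iff] at h
  rcases h with ⟨h1, h2⟩ | ⟨h1, -⟩
  · rw [hf h1, hg h2]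
  · exact absurd h1 (hne _ _)

theorem seam_card_mul_le_edges {w d ε : ℝ} (hw : 0 < w) (hε : 0 < ε)
    (hd : w + ε + 2 + 4 * w ^ 2 / ε ^ 2 ≤ d) {SA SB : Finset E3}
    (hA : IsCapsuleSample w ε SA) (hB : IsCapsuleSample w ε SB) :
    (seam SA).card * (seam SB).card ≤
      Nat.card (strictDelaunayGraph (placedSample d SA SB)).edgeSet := by
  have hquot : 0 ≤ 4 * w ^ 2 / ε ^ 2 := by positivity
  have hd0 : 0 < d := by linarith
  have hmA : ∀ p : ↥(seam SA), upper d p ∈ placedSample d SA SB := fun p =>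
    mem_placedSample.2 (Or.inl ⟨p, (mem_seam.1 p.2).1, rfl⟩)
  have hmB : ∀ p : ↥(seam SB), lower d p ∈ placedSample d SA SB := fun p =>
    mem_placedSample.2 (Or.inr ⟨p, (mem_seam.1 p.2).1, rfl⟩)
  have := card_mul_card_le_card_edgeSet (strictDelaunayGraph (placedSample d SA SB))
    (f := fun p : ↥(seam SA) => ⟨_, hmA p⟩) (g := fun p : ↥(seam SB) => ⟨_, hmB p⟩)
    (fun p q h => Subtype.ext ((upper d).injective (congrArg Subtype.val h)))
    (fun p q h => Subtype.ext ((lower d).injective (congrArg Subtype.val h)))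
    (fun p q => strictDelaunay_adj_seam hw hε hd hA hB p.2 q.2 _ _)
    (fun p q h => upper_ne_lower hd0 (hA.1 p (mem_seam.1 p.2).1) (hB.1 q (mem_seam.1 q.2).1)
      (congrArg Subtype.val h))
  simpa using this

theorem strictDelaunayGraph_le (S : Finset E3) : strictDelaunayGraph S ≤ delaunayGraph S := by
  rintro p q ⟨hne, c, r, hp, hq, hs⟩
  refine ⟨hne, c, r, hp, hq, fun s h => ?_⟩
  by_cases h1 : s = (p : E3)
  · rw [h1, hp]
  · by_cases h2 : s = (q : E3)
    · rw [h2, hq]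
    · exact (hs s h h1 h2).le

theorem card_strict_edges_le (S : Finset E3) :
    Nat.card (strictDelaunayGraph S).edgeSet ≤ Nat.card (delaunayGraph S).edgeSet :=
  Nat.card_mono (Set.toFinite _) (SimpleGraph.edgeSet_mono (strictDelaunayGraph_le S))

/-- Two samples of the model capsule assemble to a sample of the surface of two sausages at a large
distance. -/
theorem exists_sausageSurface_sample {w ε : ℝ} (hw : 0 < w) (hε : 0 < ε) {SA SB : Finset E3}
    (hA : IsCapsuleSample w ε SA) (hB : IsCapsuleSample w ε SB) {m : ℝ} (hm : 0 ≤ m)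
    (hmA : m ≤ (seam SA).card) (hmB : m ≤ (seam SB).card) :
    ∃ d > (0 : ℝ), IsC11Surface (sausageSurface w d) ∧
      Nat.card (ConnectedComponents (sausageSurface w d)) = 2 ∧
      ∃ S : Finset E3, S.card = SA.card + SB.card ∧ IsUniformSample (sausageSurface w d) ε S ∧
        m ^ 2 ≤ Nat.card (delaunayGraph S).edgeSet ∧
        m ^ 2 ≤ Nat.card (strictDelaunayGraph S).edgeSet := by
  obtain ⟨d, hd⟩ : ∃ d, w + ε + 2 + 4 * w ^ 2 / ε ^ 2 = d := ⟨_, rfl⟩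
  have hquot : 0 ≤ 4 * w ^ 2 / ε ^ 2 := by positivity
  have hd0 : 0 < d := by linarith
  have hs : m ^ 2 ≤ Nat.card (strictDelaunayGraph (placedSample d SA SB)).edgeSet := by
    have h1 : ((seam SA).card * (seam SB).card : ℝ) ≤
        Nat.card (strictDelaunayGraph (placedSample d SA SB)).edgeSet := by
      exact_mod_cast seam_card_mul_le_edges hw hε hd.le hA hB
    nlinarith
  refine ⟨d, hd0, isC11Surface_sausageSurface hw hd0, card_components_sausageSurface hw hd0,
    placedSample d SA SB, card_placedSample hd0 hA hB,
    isUniformSample_placedSample hw (by linarith) (by linarith) hA hB, hs.trans ?_, hs⟩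
  exact_mod_cast card_strict_edges_le _

/-! ### Nets are double covers -/

/-- An `ε / 2`-separated subset of the capsule whose closed balls of radius `ε / 2` cover it. -/
def IsCapsuleNet (w ε : ℝ) (S : Finset E3) : Prop :=
  (∀ p ∈ S, p ∈ capsule w) ∧ (∀ p ∈ S, ∀ q ∈ S, p ≠ q → ε / 2 ≤ dist p q) ∧
    ∀ x ∈ capsule w, ∃ p ∈ S, dist x p ≤ ε / 2

theorem exists_unit_orthogonal (a b c d : ℝ) :
    ∃ t u : ℝ, t ^ 2 + u ^ 2 = 1 ∧ t * a + u * b = 0 ∧ 0 ≤ t * c + u * d := by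
  obtain ⟨t, u, h1, h2⟩ : ∃ t u : ℝ, t ^ 2 + u ^ 2 = 1 ∧ t * a + u * b = 0 := by
    by_cases h : a ^ 2 + b ^ 2 = 0
    · have ha : a = 0 := by nlinarith [sq_nonneg a, sq_nonneg b]
      have hb : b = 0 := by nlinarith [sq_nonneg a, sq_nonneg b]
      exact ⟨1, 0, by norm_num, by simp [ha, hb]⟩
    · have hpos : 0 < a ^ 2 + b ^ 2 := lt_of_le_of_ne (by positivity) (Ne.symm h)
      have hs := Real.sq_sqrt hpos.le
      have hs0 : √(a ^ 2 + b ^ 2) ≠ 0 := (Real.sqrt_pos.2 hpos).ne'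
      refine ⟨-b / √(a ^ 2 + b ^ 2), a / √(a ^ 2 + b ^ 2), ?_, ?_⟩
      · rw [div_pow, div_pow, hs, ← add_div, div_eq_one_iff_eq h]; ring
      · field_simp; ring
  rcases le_total 0 (t * c + u * d) with h | h
  · exact ⟨t, u, h1, h2, h⟩
  · exact ⟨-t, -u, by linarith, by linarith, by linarith⟩

/-- From any point `x` of the capsule one can move by `ℓ ≤ √2` without coming closer than `ℓ` to a
prescribed point `p`. Two opposite unit tangent vectors at `x` are orthogonal to the axis; `y` is
reached along the unit circle around the projection of `x` to the axis, in the one of these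
directions that does not lead towards `p`. The bound `√2` keeps the circle on the capsule. -/
theorem exists_capsule_point_away {w : ℝ} (hw : 0 ≤ w) {ℓ : ℝ} (hℓ : ℓ ^ 2 ≤ 2)
    {x p : E3} (hx : x ∈ capsule w) (hp : p ∈ capsule w) :
    ∃ y ∈ capsule w, dist x y ^ 2 = ℓ ^ 2 ∧ ℓ ^ 2 ≤ dist y p ^ 2 := by
  obtain ⟨t, u, h1, h2, h3⟩ := exists_unit_orthogonal (x 1) (x 2) (x 1 - p 1) (x 2 - p 2)
  obtain ⟨C, hC⟩ : ∃ C, C = 1 - ℓ ^ 2 / 2 := ⟨_, rfl⟩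
  have hC0 : 0 ≤ C := by linarith
  have hC1 : C ≤ 1 := by linarith [sq_nonneg ℓ]
  have hσ : √(1 - C ^ 2) ^ 2 = 1 - C ^ 2 := Real.sq_sqrt (by nlinarith)
  have hσ0 : 0 ≤ √(1 - C ^ 2) := Real.sqrt_nonneg _
  generalize √(1 - C ^ 2) = σ at hσ hσ0
  have hx1 := mem_capsule.1 hx
  -- The unit ball around the projection of `x` does not contain `p` in its interior.
  have hax := one_le_dist_axis hw hp (axisOffset_axisPoint hw x)
  have hax : 1 ≤ dist (axisPoint w x) p ^ 2 := by nlinarith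
  rw [E3.dist_sq] at hax
  have hc : axisPoint w x 0 = x 0 - shrink w (x 0) := by simp [shrink]
  rw [hc, axisPoint_one, axisPoint_two] at hax
  have hray := shrink_ray hw (x 0) hC0
  generalize shrink w (x 0) = s at *
  refine ⟨!₂[x 0 - s + C * s, C * x 1 + σ * t, C * x 2 + σ * u], ?_, ?_, ?_⟩
  · rw [mem_capsule]
    change shrink w (x 0 - s + C * s) ^ 2 + (C * x 1 + σ * t) ^ 2 + (C * x 2 + σ * u) ^ 2 = 1
    rw [hray]
    linear_combination C ^ 2 * hx1 + σ ^ 2 * h1 + 2 * C * σ * h2 + hσ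
  · rw [E3.dist_sq]
    change (x 0 - (x 0 - s + C * s)) ^ 2 + (x 1 - (C * x 1 + σ * t)) ^ 2 +
      (x 2 - (C * x 2 + σ * u)) ^ 2 = ℓ ^ 2
    linear_combination (1 - C) ^ 2 * hx1 + σ ^ 2 * h1 - 2 * (1 - C) * σ * h2 + hσ - 2 * hC
  · rw [E3.dist_sq]
    change ℓ ^ 2 ≤ (x 0 - s + C * s - p 0) ^ 2 + (C * x 1 + σ * t - p 1) ^ 2 +
      (C * x 2 + σ * u - p 2) ^ 2
    have e : (x 0 - s + C * s - p 0) ^ 2 + (C * x 1 + σ * t - p 1) ^ 2 +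
        (C * x 2 + σ * u - p 2) ^ 2 = ℓ ^ 2 +
        C * ((x 0 - p 0) ^ 2 + (x 1 - p 1) ^ 2 + (x 2 - p 2) ^ 2) +
        (1 - C) * ((x 0 - s - p 0) ^ 2 + (0 - p 1) ^ 2 + (0 - p 2) ^ 2 - 1) +
        2 * (σ * (t * (x 1 - p 1) + u * (x 2 - p 2))) := by
      linear_combination (C ^ 2 - C) * hx1 + σ ^ 2 * h1 - 2 * (1 - C) * σ * h2 + hσ - 2 * hC
    rw [e]
    have k1 : 0 ≤ C * ((x 0 - p 0) ^ 2 + (x 1 - p 1) ^ 2 + (x 2 - p 2) ^ 2) := by positivity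
    have k2 := mul_nonneg (sub_nonneg.2 hC1) (sub_nonneg.2 hax)
    have k3 := mul_nonneg hσ0 h3
    linarith

/-- For `ε < 2√2` every point of the capsule has a second point of a net within `ε`: it is found
near a point at distance slightly more than `ε / 2` that the first one does not cover. -/
theorem IsCapsuleNet.isCapsuleSample {w ε : ℝ} (hw : 0 ≤ w) (hε : 0 < ε) (hε8 : ε ^ 2 < 8)
    {S : Finset E3} (hS : IsCapsuleNet w ε S) : IsCapsuleSample w ε S := by
  refine ⟨hS.1, hS.2.1, fun x hx => ?_⟩
  obtain ⟨p, hp, hxp⟩ := hS.2.2 x hx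
  by_contra! hcon
  have hfar : ∀ q ∈ S, q ≠ p → ε < dist x q := fun q hq hne =>
    hcon p hp q hq hne.symm (by linarith)
  have hev : ∀ᶠ ℓ in 𝓝[>] (ε / 2), (∀ q ∈ S, q ≠ p → ε / 2 + ℓ < dist x q) ∧ ℓ ^ 2 < 2 := by
    refine Filter.Eventually.filter_mono nhdsWithin_le_nhds (Filter.Eventually.and ?_ ?_)
    · rw [Finset.eventually_all]
      intro q hq
      by_cases hne : q = p
      · exact Filter.Eventually.of_forall fun _ h => absurd hne h
      · have h1 : Continuous fun ℓ : ℝ => ε / 2 + ℓ := by fun_prop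
        have h2 := h1.continuousAt.eventually_lt (x₀ := ε / 2)
          (continuousAt_const (y := dist x q)) (by linarith [hfar q hq hne])
        filter_upwards [h2] with ℓ h _
        exact h
    · exact (continuous_pow 2).continuousAt.eventually_lt continuousAt_const (by linarith)
  -- A point `y` at distance `ℓ` from `x` that is not covered by `p` must be covered by a point `q`
  -- that is too close to `x`.
  obtain ⟨ℓ, ⟨h1, h2⟩, h3⟩ := (hev.and self_mem_nhdsWithin).exists
  have h3 : ε / 2 < ℓ := h3
  obtain ⟨y, hy, hxy, hyp⟩ := exists_capsule_point_away hw h2.le hx (hS.1 p hp)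
  have hxy : dist x y = ℓ := (sq_eq_sq₀ dist_nonneg (by linarith)).1 hxy
  obtain ⟨q, hq, hyq⟩ := hS.2.2 y hy
  by_cases hne : q = p
  · subst hne
    have : dist y q ^ 2 ≤ (ε / 2) ^ 2 := pow_le_pow_left₀ dist_nonneg hyq 2
    nlinarith
  · have := h1 q hq hne
    have := dist_triangle x y q
    linarith

/-! ### Lengthening the capsule -/

/-- The map of the line that shifts the two half-lines away from each other by `t`. -/
noncomputable def stretchCoord (t u : ℝ) : ℝ := if 0 ≤ u then u + t else u - t

/-- The map of space that shifts the two half-spaces `0 ≤ p 0` and `p 0 < 0` away from each other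
along the first axis by `t`. -/
noncomputable def stretch (t : ℝ) (p : E3) : E3 := !₂[stretchCoord t (p 0), p 1, p 2]

theorem stretch_zero (p : E3) : stretch 0 p = p := by
  apply E3.ext_coords <;> simp [stretch, stretchCoord]

theorem sq_sub_le_sq_stretchCoord_sub {t : ℝ} (ht : 0 ≤ t) (u v : ℝ) :
    (u - v) ^ 2 ≤ (stretchCoord t u - stretchCoord t v) ^ 2 := by
  unfold stretchCoord
  split_ifs <;> nlinarith

theorem dist_le_dist_stretch {t : ℝ} (ht : 0 ≤ t) (p q : E3) :
    dist p q ≤ dist (stretch t p) (stretch t q) := by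
  apply E3.dist_le_dist
  have := sq_sub_le_sq_stretchCoord_sub ht (p 0) (q 0)
  change _ ≤ (stretchCoord t (p 0) - stretchCoord t (q 0)) ^ 2 + (p 1 - q 1) ^ 2 + (p 2 - q 2) ^ 2
  linarith

theorem dist_stretch_stretch (t t' : ℝ) (p : E3) :
    dist (stretch t p) (stretch t' p) = |t - t'| := by
  rw [← sq_eq_sq₀ dist_nonneg (abs_nonneg _), sq_abs, E3.dist_sq]
  change (stretchCoord t (p 0) - stretchCoord t' (p 0)) ^ 2 + (p 1 - p 1) ^ 2 + (p 2 - p 2) ^ 2 = _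
  unfold stretchCoord
  split_ifs <;> ring

theorem shrink_stretchCoord {w t : ℝ} (hw : 0 ≤ w) (ht : 0 ≤ t) (u : ℝ) :
    shrink (w + t) (stretchCoord t u) = shrink w u := by
  unfold stretchCoord
  rcases shrink_cases hw u with ⟨h, e⟩ | ⟨h, e⟩ | ⟨h, h', e⟩ <;> rw [e] <;> split_ifs with h0
  · rw [shrink_of_le] <;> linarith
  · linarith
  · linarith
  · rw [shrink_of_le_neg] <;> linarith
  · rw [shrink_eq_zero] <;> linarith
  · rw [shrink_eq_zero] <;> linarith

theorem stretch_mem_capsule {w t : ℝ} (hw : 0 ≤ w) (ht : 0 ≤ t) {p : E3} (hp : p ∈ capsule w) :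
    stretch t p ∈ capsule (w + t) := by
  rw [mem_capsule] at hp ⊢
  change shrink (w + t) (stretchCoord t (p 0)) ^ 2 + p 1 ^ 2 + p 2 ^ 2 = 1
  rwa [shrink_stretchCoord hw ht]

theorem shrink_shrink {w t : ℝ} (hw : 0 ≤ w) (ht : 0 ≤ t) (u : ℝ) :
    shrink w (shrink t u) = shrink (w + t) u := by
  rcases shrink_cases ht u with ⟨h, e⟩ | ⟨h, e⟩ | ⟨h, h', e⟩ <;> rw [e] <;>
    rcases shrink_cases (add_nonneg hw ht) u with ⟨k, f⟩ | ⟨k, f⟩ | ⟨k, k', f⟩ <;> rw [f]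
  all_goals first
    | (rw [shrink_of_le hw (by linarith)]; ring1)
    | (rw [shrink_of_le_neg hw (by linarith)]; ring1)
    | (rw [shrink_eq_zero (by linarith) (by linarith)]; try linarith)

theorem sq_sub_shrink_le {t : ℝ} (ht : 0 ≤ t) (u : ℝ) : (u - shrink t u) ^ 2 ≤ t ^ 2 := by
  rcases shrink_cases ht u with ⟨h, e⟩ | ⟨h, e⟩ | ⟨h, h', e⟩ <;> rw [e] <;> nlinarith

/-- Capsules of different lengths are close to each other. -/
theorem exists_capsule_near {w w' : ℝ} (hw : 0 ≤ w) (hw' : 0 ≤ w') {y : E3} (hy : y ∈ capsule w) :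
    ∃ y' ∈ capsule w', dist y y' ≤ |w - w'| := by
  rcases le_total w w' with h | h
  · refine ⟨stretch (w' - w) y, ?_, ?_⟩
    · have := stretch_mem_capsule hw (sub_nonneg.2 h) hy
      rwa [add_sub_cancel] at this
    · have := dist_stretch_stretch 0 (w' - w) y
      rw [stretch_zero] at this
      rw [this]
      exact le_of_eq (by congr 1; ring)
  · refine ⟨!₂[shrink (w - w') (y 0), y 1, y 2], ?_, ?_⟩
    · rw [mem_capsule] at hy ⊢
      change shrink w' (shrink (w - w') (y 0)) ^ 2 + y 1 ^ 2 + y 2 ^ 2 = 1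
      rw [shrink_shrink hw' (sub_nonneg.2 h), add_sub_cancel]
      exact hy
    · refine E3.dist_le (abs_nonneg _) ?_
      rw [sq_abs]
      have := sq_sub_shrink_le (sub_nonneg.2 h) (y 0)
      change (y 0 - shrink (w - w') (y 0)) ^ 2 + (y 1 - y 1) ^ 2 + (y 2 - y 2) ^ 2 ≤ _
      linarith

theorem capsule_nonempty {w : ℝ} (hw : 0 ≤ w) : (capsule w).Nonempty :=
  ⟨_, e2_mem_capsule 0 (by linarith) hw⟩

/-- The covering radius on the capsule of half-length `w + t` of the points of `S`, stretched by
`t`. -/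
noncomputable def coveringRadius (w : ℝ) (S : Finset E3) (t : ℝ) : ℝ :=
  sSup ((fun y => Metric.infDist y (stretch t '' S)) '' capsule (w + t))

theorem infDist_le_coveringRadius {w t : ℝ} (hw : 0 ≤ w) (ht : 0 ≤ t) (S : Finset E3) {y : E3}
    (hy : y ∈ capsule (w + t)) : Metric.infDist y (stretch t '' S) ≤ coveringRadius w S t :=
  le_csSup ((isCompact_capsule (add_nonneg hw ht)).image (Metric.continuous_infDist_pt _)).bddAbove
    ⟨y, hy, rfl⟩

theorem coveringRadius_le_add {w : ℝ} (hw : 0 ≤ w) {S : Finset E3} (hS : S.Nonempty) {t t' : ℝ}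
    (ht : 0 ≤ t) (ht' : 0 ≤ t') :
    coveringRadius w S t ≤ coveringRadius w S t' + 2 * |t - t'| := by
  refine csSup_le ((capsule_nonempty (add_nonneg hw ht)).image _) ?_
  rintro _ ⟨y, hy, rfl⟩
  obtain ⟨y', hy', hd⟩ := exists_capsule_near (add_nonneg hw ht) (add_nonneg hw ht') hy
  rw [add_sub_add_left_eq_sub] at hd
  have hne : (stretch t' '' (S : Set E3)).Nonempty := Set.Nonempty.image _ hS
  obtain ⟨_, ⟨s, hs, rfl⟩, hs'⟩ :=
    (S.finite_toSet.image (stretch t')).isCompact.exists_infDist_eq_dist hne y'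
  have h1 := infDist_le_coveringRadius hw ht' S hy'
  have h2 : Metric.infDist y (stretch t '' S) ≤ dist y (stretch t s) :=
    Metric.infDist_le_dist_of_mem ⟨s, hs, rfl⟩
  have h3 := dist_triangle4 y y' (stretch t' s) (stretch t s)
  rw [dist_stretch_stretch, abs_sub_comm t' t] at h3
  simp only
  linarith

theorem seam_card_le_of_maps {S T : Finset E3} (f : E3 → E3) (hf : Function.Injective f)
    (h2 : ∀ p, f p 2 = p 2) (hfT : ∀ p ∈ S, f p ∈ T) : (seam S).card ≤ (seam T).card :=
  Finset.card_le_card_of_injOn f (fun p hp => by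
    have hp := mem_seam.1 hp
    exact mem_seam.2 ⟨hfT p hp.1, (h2 p).trans hp.2⟩) hf.injOn

/-- A net can be enlarged by exactly one point on a longer capsule, on which there is still a net of
the original size: stretch until the covering radius is exactly `ε / 2`, and add a point where it
is attained. -/
theorem IsCapsuleNet.exists_succ {w ε : ℝ} (hw : 0 < w) (hε : 0 < ε) {S : Finset E3}
    (hS : IsCapsuleNet w ε S) :
    ∃ w' > (0 : ℝ), ∃ S₀ S₁ : Finset E3, IsCapsuleNet w' ε S₀ ∧ IsCapsuleNet w' ε S₁ ∧
      S₀.card = S.card ∧ S₁.card = S.card + 1 ∧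
      (seam S).card ≤ (seam S₀).card ∧ (seam S).card ≤ (seam S₁).card := by
  classical
  have hSne : S.Nonempty := by
    obtain ⟨x, hx⟩ := capsule_nonempty hw.le
    obtain ⟨p, hp, -⟩ := hS.2.2 x hx
    exact ⟨p, hp⟩
  have hcont : ContinuousOn (coveringRadius w S) (Set.Icc 0 ε) := by
    refine LipschitzOnWith.continuousOn (K := 2) (LipschitzOnWith.of_dist_le_mul ?_)
    intro t ht t' ht'
    have h1 := coveringRadius_le_add hw.le hSne ht.1 ht'.1
    have h2 := coveringRadius_le_add hw.le hSne ht'.1 ht.1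
    rw [abs_sub_comm] at h2
    rw [Real.dist_eq, Real.dist_eq, NNReal.coe_ofNat, abs_le]
    constructor <;> linarith
  have hlow : coveringRadius w S 0 ≤ ε / 2 := by
    refine csSup_le ((capsule_nonempty (by linarith)).image _) ?_
    rintro _ ⟨y, hy, rfl⟩
    rw [add_zero] at hy
    obtain ⟨p, hp, hd⟩ := hS.2.2 y hy
    have hmem : p ∈ stretch 0 '' (S : Set E3) := ⟨p, hp, stretch_zero p⟩
    exact (Metric.infDist_le_dist_of_mem hmem).trans hd
  -- After stretching by `ε`, no point of the sample is near the middle of the capsule.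
  have hhigh : ε / 2 ≤ coveringRadius w S ε := by
    refine le_trans ?_ (infDist_le_coveringRadius hw.le hε.le S
      (e2_mem_capsule 0 (by linarith) (by linarith)))
    have hne : (stretch ε '' (S : Set E3)).Nonempty := Set.Nonempty.image _ hSne
    rw [Metric.le_infDist hne]
    rintro _ ⟨s, -, rfl⟩
    refine E3.le_dist ?_
    change _ ≤ (0 - stretchCoord ε (s 0)) ^ 2 + (0 - s 1) ^ 2 + (1 - s 2) ^ 2
    have : ε ^ 2 ≤ (0 - stretchCoord ε (s 0)) ^ 2 := by
      unfold stretchCoord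
      split_ifs <;> nlinarith
    nlinarith [sq_nonneg (0 - s 1), sq_nonneg (1 - s 2)]
  obtain ⟨t, ⟨ht, -⟩, hr⟩ := intermediate_value_Icc hε.le hcont ⟨hlow, hhigh⟩
  have hinj : Function.Injective (stretch t) := fun p q h => by
    have := dist_le_dist_stretch ht p q
    rw [h, dist_self] at this
    exact dist_le_zero.1 this
  have hw't : 0 ≤ w + t := add_nonneg hw.le ht
  obtain ⟨y, hy, hmax⟩ := (isCompact_capsule hw't).exists_sSup_image_eq
    (capsule_nonempty hw't) (Metric.continuous_infDist_pt (stretch t '' (S : Set E3))).continuousOn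
  have hy' : Metric.infDist y (stretch t '' S) = ε / 2 := hmax.symm.trans hr
  have hnet : IsCapsuleNet (w + t) ε (S.image (stretch t)) := by
    refine ⟨?_, ?_, ?_⟩
    · intro p hp
      obtain ⟨s, hs, rfl⟩ := Finset.mem_image.1 hp
      exact stretch_mem_capsule hw.le ht (hS.1 s hs)
    · intro p hp q hq hne
      obtain ⟨s, hs, rfl⟩ := Finset.mem_image.1 hp
      obtain ⟨s', hs', rfl⟩ := Finset.mem_image.1 hq
      exact (hS.2.1 s hs s' hs' fun h => hne (congrArg _ h)).trans (dist_le_dist_stretch ht _ _)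
    · intro x hx
      have hne : (stretch t '' (S : Set E3)).Nonempty := Set.Nonempty.image _ hSne
      obtain ⟨_, ⟨s, hs, rfl⟩, hs'⟩ :=
        (S.finite_toSet.image (stretch t)).isCompact.exists_infDist_eq_dist hne x
      refine ⟨_, Finset.mem_image_of_mem _ hs, ?_⟩
      rw [← hs', ← hr]
      exact infDist_le_coveringRadius hw.le ht S hx
  have hyfar : ∀ p ∈ S.image (stretch t), ε / 2 ≤ dist y p := fun p hp => by
    rw [← hy']
    refine Metric.infDist_le_dist_of_mem ?_
    rwa [← Finset.coe_image]
  have hyS : y ∉ S.image (stretch t) := fun h => by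
    have := hyfar y h
    rw [dist_self] at this
    linarith
  refine ⟨w + t, by linarith, S.image (stretch t), insert y (S.image (stretch t)), hnet,
    ⟨?_, ?_, ?_⟩, Finset.card_image_of_injective _ hinj, ?_, ?_, ?_⟩
  · intro p hp
    rcases Finset.mem_insert.1 hp with rfl | hp
    · exact hy
    · exact hnet.1 p hp
  · intro p hp q hq hne
    rcases Finset.mem_insert.1 hp with rfl | hp' <;>
      rcases Finset.mem_insert.1 hq with rfl | hq'
    · exact absurd rfl hne
    · exact hyfar q hq'
    · rw [dist_comm]
      exact hyfar p hp'
    · exact hnet.2.1 p hp' q hq' hne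
  · intro x hx
    obtain ⟨p, hp, hd⟩ := hnet.2.2 x hx
    exact ⟨p, Finset.mem_insert_of_mem hp, hd⟩
  · rw [Finset.card_insert_of_notMem hyS, Finset.card_image_of_injective _ hinj]
  · exact seam_card_le_of_maps _ hinj (fun _ => rfl) fun p hp => Finset.mem_image_of_mem _ hp
  · exact seam_card_le_of_maps _ hinj (fun _ => rfl) fun p hp =>
      Finset.mem_insert_of_mem (Finset.mem_image_of_mem _ hp)

/-- Repeated lengthening realizes every larger number of points. -/
theorem IsCapsuleNet.exists_card {w ε : ℝ} (hw : 0 < w) (hε : 0 < ε) {S : Finset E3}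
    (hS : IsCapsuleNet w ε S) {N : ℕ} (hN : S.card ≤ N) :
    ∃ w' > (0 : ℝ), ∃ S₀ S₁ : Finset E3, IsCapsuleNet w' ε S₀ ∧ IsCapsuleNet w' ε S₁ ∧
      S₀.card = N ∧ S₁.card = N + 1 ∧
      (seam S).card ≤ (seam S₀).card ∧ (seam S).card ≤ (seam S₁).card := by
  induction N, hN using Nat.le_induction with
  | base => exact hS.exists_succ hw hε
  | succ N hN ih =>
    obtain ⟨w', hw', -, S₁, -, h1, -, hc, -, hm⟩ := ih
    obtain ⟨w'', hw'', T₀, T₁, k0, k1, c0, c1, m0, m1⟩ := h1.exists_succ hw' hε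
    exact ⟨w'', hw'', T₀, T₁, k0, k1, c0.trans hc, by rw [c1, hc], hm.trans m0, hm.trans m1⟩

/-! ### Packing bound -/

/-- Convexity of the region bounded by the capsule: it lies on the inner side of each tangent
plane. -/
theorem inner_axisOffset_sub_nonpos {w : ℝ} (hw : 0 ≤ w) {p q : E3} (hp : p ∈ capsule w)
    (hq : q ∈ capsule w) : inner ℝ (axisOffset w p) (q - p) ≤ 0 := by
  have e : q - p = -(axisPoint w p - axisPoint w q) + (axisOffset w q - axisOffset w p) := by
    conv_lhs => rw [← axisPoint_add_axisOffset w p, ← axisPoint_add_axisOffset w q]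
    abel
  have h1 := inner_axisOffset_nonneg hw p q
  have h2 := real_inner_le_norm (axisOffset w p) (axisOffset w q)
  have hp : ‖axisOffset w p‖ = 1 := hp
  have hq : ‖axisOffset w q‖ = 1 := hq
  rw [e, inner_add_right, inner_neg_right, inner_sub_right _ (axisOffset w q),
    real_inner_self_eq_norm_sq]
  rw [hp, hq] at h2
  rw [hp]
  linarith

theorem sq_le_of_inner_nonpos {a b c x y z : ℝ} (h : a ^ 2 + b ^ 2 + c ^ 2 = 1)
    (hin : a * x + b * y + c * z ≤ 0) (ha : 1 / 2 ≤ a) :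
    x ≤ 0 ∨ x ^ 2 ≤ 4 * (y ^ 2 + z ^ 2) := by
  rcases le_or_gt x 0 with hx | hx
  · exact Or.inl hx
  · right
    have h1 : a * x ≤ -(b * y + c * z) := by linarith
    have h2 : (a * x) ^ 2 ≤ (-(b * y + c * z)) ^ 2 :=
      pow_le_pow_left₀ (by positivity) h1 2
    have h3 : (b * y + c * z) ^ 2 ≤ (b ^ 2 + c ^ 2) * (y ^ 2 + z ^ 2) := by
      nlinarith [sq_nonneg (b * z - c * y)]
    have h4 : (b ^ 2 + c ^ 2) * (y ^ 2 + z ^ 2) ≤ 1 * (y ^ 2 + z ^ 2) :=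
      mul_le_mul_of_nonneg_right (by nlinarith [sq_nonneg a]) (by positivity)
    have h5 : 1 / 4 ≤ a ^ 2 := by nlinarith
    nlinarith [mul_le_mul_of_nonneg_right h5 (sq_nonneg x)]

/-- Where the normals at two points have a common large component, the difference of the points is
controlled by its other two components. -/
theorem sq_le_of_normals {a b c a' b' c' x y z : ℝ} (h : a ^ 2 + b ^ 2 + c ^ 2 = 1)
    (h' : a' ^ 2 + b' ^ 2 + c' ^ 2 = 1) (hin : a * x + b * y + c * z ≤ 0)
    (hin' : a' * x + b' * y + c' * z ≥ 0)
    (ha : (1 / 2 ≤ a ∧ 1 / 2 ≤ a') ∨ (a ≤ -(1 / 2) ∧ a' ≤ -(1 / 2))) :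
    x ^ 2 ≤ 4 * (y ^ 2 + z ^ 2) := by
  have key : ∀ {a b c a' b' c' x : ℝ}, a ^ 2 + b ^ 2 + c ^ 2 = 1 → a' ^ 2 + b' ^ 2 + c' ^ 2 = 1 →
      a * x + b * y + c * z ≤ 0 → a' * x + b' * y + c' * z ≥ 0 → 1 / 2 ≤ a → 1 / 2 ≤ a' →
      x ^ 2 ≤ 4 * (y ^ 2 + z ^ 2) := by
    intro a b c a' b' c' x h h' hin hin' ha ha'
    rcases sq_le_of_inner_nonpos h hin ha with h1 | h1
    · rcases sq_le_of_inner_nonpos (x := -x) (y := -y) (z := -z) h' (by linarith) ha' with h2 | h2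
      · have : x = 0 := by linarith
        rw [this, zero_pow two_ne_zero]; positivity
      · simpa using h2
    · exact h1
  rcases ha with ⟨ha, ha'⟩ | ⟨ha, ha'⟩
  · exact key h h' hin hin' ha ha'
  · have := key (a := -a) (b := b) (c := c) (a' := -a') (b' := b') (c' := c') (x := -x)
      (by rw [neg_sq]; exact h) (by rw [neg_sq]; exact h') (by linarith) (by linarith)
      (by linarith) (by linarith)
    simpa using this

theorem card_Icc_floor_le {y : ℝ} (hy : 0 ≤ y) :
    ((Finset.Icc ⌊-y⌋ ⌊y⌋).card : ℝ) ≤ 2 * y + 2 := by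
  have h1 := Int.floor_le y
  have h2 := Int.lt_floor_add_one (-y)
  have h3 : ⌊-y⌋ ≤ ⌊y⌋ := Int.floor_le_floor (by linarith)
  have h4 : (((Finset.Icc ⌊-y⌋ ⌊y⌋).card : ℤ) : ℝ) = ⌊y⌋ + 1 - ⌊-y⌋ := by
    rw [Int.card_Icc, Int.toNat_of_nonneg (by linarith)]
    push_cast
    ring
  rw [Int.cast_natCast] at h4
  linarith

/-- A separated set that projects to a rectangle with bounded distortion has few points: they lie in
different cells of a grid of mesh `ε / 7`. -/
theorem card_le_of_projection {T : Finset E3} {X Y : E3 → ℝ} {A B ε : ℝ} (hA : 1 ≤ A)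
    (hB : 1 ≤ B) (hε : 0 < ε) (hε3 : ε ≤ 3) (hX : ∀ p ∈ T, |X p| ≤ A) (hY : ∀ p ∈ T, |Y p| ≤ B)
    (hsep : ∀ p ∈ T, ∀ q ∈ T, p ≠ q → ε / 2 ≤ dist p q)
    (hd : ∀ p ∈ T, ∀ q ∈ T, dist p q ^ 2 ≤ 5 * ((X p - X q) ^ 2 + (Y p - Y q) ^ 2)) :
    (T.card : ℝ) ≤ 400 * (A * B) / ε ^ 2 := by
  have hmem : ∀ {x M : ℝ}, |x| ≤ M → ⌊7 * x / ε⌋ ∈ Finset.Icc ⌊-(7 * M / ε)⌋ ⌊7 * M / ε⌋ := by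
    intro x M h
    obtain ⟨h1, h2⟩ := abs_le.1 h
    rw [Finset.mem_Icc]
    constructor <;> apply Int.floor_le_floor
    · rw [← neg_div]
      gcongr
      linarith
    · gcongr
  have hcell : ∀ {x y : ℝ}, ⌊7 * x / ε⌋ = ⌊7 * y / ε⌋ → (x - y) ^ 2 ≤ ε ^ 2 / 49 := by
    intro x y h
    have h1 := Int.abs_sub_lt_one_of_floor_eq_floor h
    have h2 : (7 * x / ε - 7 * y / ε) ^ 2 ≤ 1 := by
      rw [sq_le_one_iff_abs_le_one]
      exact h1.le
    have h3 : 7 * x / ε - 7 * y / ε = 7 * (x - y) / ε := by ring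
    rw [h3, div_pow, div_le_one (by positivity)] at h2
    nlinarith
  have hcard : T.card ≤ (Finset.Icc ⌊-(7 * A / ε)⌋ ⌊7 * A / ε⌋ ×ˢ
      Finset.Icc ⌊-(7 * B / ε)⌋ ⌊7 * B / ε⌋).card := by
    refine Finset.card_le_card_of_injOn (fun p => (⌊7 * X p / ε⌋, ⌊7 * Y p / ε⌋)) ?_ ?_
    · intro p hp
      exact Finset.mem_coe.2 (Finset.mem_product.2 ⟨hmem (hX p hp), hmem (hY p hp)⟩)
    · intro p hp q hq h
      by_contra hne
      obtain ⟨h1, h2⟩ := Prod.mk.inj h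
      have := hd p hp q hq
      have := hcell h1
      have := hcell h2
      -- In a common cell, `dist p q ^ 2 ≤ 5 * (2 / 49) * ε ^ 2`, which is less than `ε ^ 2 / 4`.
      have := hsep p hp q hq hne
      nlinarith [mul_pos hε hε]
  have hside : ∀ {M : ℝ}, 1 ≤ M →
      ((Finset.Icc ⌊-(7 * M / ε)⌋ ⌊7 * M / ε⌋).card : ℝ) ≤ 20 * M / ε := by
    intro M hM
    refine (card_Icc_floor_le (by positivity)).trans ?_
    rw [← sub_nonneg]
    have : 20 * M / ε - (2 * (7 * M / ε) + 2) = (6 * M - 2 * ε) / ε := by field_simp; ring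
    rw [this]
    exact div_nonneg (by linarith) hε.le
  calc (T.card : ℝ) ≤ _ := Nat.cast_le.2 hcard
    _ ≤ (20 * A / ε) * (20 * B / ε) := by
      rw [Finset.card_product, Nat.cast_mul]
      exact mul_le_mul (hside hA) (hside hB) (Nat.cast_nonneg _) (by positivity)
    _ = 400 * (A * B) / ε ^ 2 := by field_simp; ring

open Classical in
/-- The points of `S` whose normal has `i`-th component at least `1 / 2` (if `b` holds) or at most
`-1 / 2` (otherwise). -/
noncomputable def normalPatch (w : ℝ) (S : Finset E3) (i : Fin 3) (b : Bool) : Finset E3 :=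
  S.filter fun p => if b then 1 / 2 ≤ axisOffset w p i else axisOffset w p i ≤ -(1 / 2)

theorem card_normalPatch_le {w ε : ℝ} (hw : 0 ≤ w) (hε : 0 < ε) (hε3 : ε ≤ 3) {S : Finset E3}
    (hS : ∀ p ∈ S, p ∈ capsule w) (hsep : ∀ p ∈ S, ∀ q ∈ S, p ≠ q → ε / 2 ≤ dist p q)
    (i : Fin 3) (b : Bool) :
    ((normalPatch w S i b).card : ℝ) ≤ 400 * (w + 1) / ε ^ 2 := by
  have hsub : ∀ p ∈ normalPatch w S i b, p ∈ S := fun p hp => (Finset.mem_filter.1 hp).1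
  have hsep' : ∀ p ∈ normalPatch w S i b, ∀ q ∈ normalPatch w S i b, p ≠ q → ε / 2 ≤ dist p q :=
    fun p hp q hq => hsep p (hsub p hp) q (hsub q hq)
  have hnormal : ∀ p ∈ normalPatch w S i b, ∀ q ∈ normalPatch w S i b,
      (1 / 2 ≤ axisOffset w p i ∧ 1 / 2 ≤ axisOffset w q i) ∨
        (axisOffset w p i ≤ -(1 / 2) ∧ axisOffset w q i ≤ -(1 / 2)) := by
    intro p hp q hq
    have h1 := (Finset.mem_filter.1 hp).2
    have h2 := (Finset.mem_filter.1 hq).2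
    cases b
    · exact Or.inr ⟨h1, h2⟩
    · exact Or.inl ⟨h1, h2⟩
  have hunit : ∀ p ∈ normalPatch w S i b, axisOffset w p 0 ^ 2 + axisOffset w p 1 ^ 2 +
      axisOffset w p 2 ^ 2 = 1 := fun p hp => mem_capsule.1 (hS p (hsub p hp))
  have hin : ∀ p ∈ normalPatch w S i b, ∀ q ∈ normalPatch w S i b,
      axisOffset w p 0 * (q 0 - p 0) + axisOffset w p 1 * (q 1 - p 1) +
        axisOffset w p 2 * (q 2 - p 2) ≤ 0 := by
    intro p hp q hq
    have := inner_axisOffset_sub_nonpos hw (hS p (hsub p hp)) (hS q (hsub q hq))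
    rwa [E3.inner_eq] at this
  have h0 : ∀ p ∈ normalPatch w S i b, |p 0| ≤ w + 1 := fun p hp =>
    capsule_zero_bound hw (hS p (hsub p hp))
  have h1 : ∀ p ∈ normalPatch w S i b, |p 1| ≤ 1 := fun p hp =>
    capsule_one_bound (hS p (hsub p hp))
  have h2 : ∀ p ∈ normalPatch w S i b, |p 2| ≤ 1 := fun p hp =>
    capsule_two_bound (hS p (hsub p hp))
  have hw1 : 1 ≤ w + 1 := by linarith
  fin_cases i
  · refine (card_le_of_projection (X := fun p => p 1) (Y := fun p => p 2) le_rfl le_rfl hε hε3 h1 h2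
      hsep' fun p hp q hq => ?_).trans ?_
    · have := sq_le_of_normals (hunit p hp) (hunit q hq) (hin p hp q hq)
        (by linarith [hin q hq p hp]) (hnormal p hp q hq)
      rw [E3.dist_sq]
      linarith
    · gcongr
      linarith
  · rw [← mul_one (w + 1)]
    refine card_le_of_projection (X := fun p => p 0) (Y := fun p => p 2) hw1 le_rfl hε hε3 h0 h2
      hsep' fun p hp q hq => ?_
    have := sq_le_of_normals (a := axisOffset w p 1) (a' := axisOffset w q 1)
      (b := axisOffset w p 0) (c := axisOffset w p 2) (y := q 0 - p 0)
      (z := q 2 - p 2) (b' := axisOffset w q 0) (c' := axisOffset w q 2)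
      (by linarith [hunit p hp]) (by linarith [hunit q hq]) (x := q 1 - p 1)
      (by linarith [hin p hp q hq]) (by linarith [hin q hq p hp]) (hnormal p hp q hq)
    rw [E3.dist_sq]
    linarith
  · rw [← mul_one (w + 1)]
    refine card_le_of_projection (X := fun p => p 0) (Y := fun p => p 1) hw1 le_rfl hε hε3 h0 h1
      hsep' fun p hp q hq => ?_
    have := sq_le_of_normals (a := axisOffset w p 2) (a' := axisOffset w q 2)
      (b := axisOffset w p 0) (c := axisOffset w p 1) (y := q 0 - p 0)
      (z := q 1 - p 1) (b' := axisOffset w q 0) (c' := axisOffset w q 1)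
      (by linarith [hunit p hp]) (by linarith [hunit q hq]) (x := q 2 - p 2)
      (by linarith [hin p hp q hq]) (by linarith [hin q hq p hp]) (hnormal p hp q hq)
    rw [E3.dist_sq]
    linarith

/-- The number of points of a separated subset of the capsule is at most of the order of the area
divided by `ε ^ 2`. -/
theorem card_le_of_separated {w ε : ℝ} (hw : 0 ≤ w) (hε : 0 < ε) (hε3 : ε ≤ 3) {S : Finset E3}
    (hS : ∀ p ∈ S, p ∈ capsule w) (hsep : ∀ p ∈ S, ∀ q ∈ S, p ≠ q → ε / 2 ≤ dist p q) :
    (S.card : ℝ) ≤ 2400 * (w + 1) / ε ^ 2 := by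
  classical
  have hcover : S ⊆ (Finset.univ : Finset (Fin 3 × Bool)).biUnion
      fun ib => normalPatch w S ib.1 ib.2 := by
    intro p hp
    have hu := mem_capsule.1 (hS p hp)
    have hex : ∃ i : Fin 3, 1 / 4 ≤ axisOffset w p i ^ 2 := by
      by_contra! hcon
      have k0 : shrink w (p 0) ^ 2 < 1 / 4 := hcon 0
      have k1 : p 1 ^ 2 < 1 / 4 := hcon 1
      have k2 : p 2 ^ 2 < 1 / 4 := hcon 2
      linarith
    obtain ⟨i, hi⟩ := hex
    rw [Finset.mem_biUnion]
    rcases le_total 0 (axisOffset w p i) with h | h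
    · refine ⟨(i, true), Finset.mem_univ _, Finset.mem_filter.2 ⟨hp, ?_⟩⟩
      simp only [if_true]
      nlinarith
    · refine ⟨(i, false), Finset.mem_univ _, Finset.mem_filter.2 ⟨hp, ?_⟩⟩
      simp only [Bool.false_eq_true, if_false]
      nlinarith
  have hle := (Finset.card_le_card hcover).trans Finset.card_biUnion_le
  calc (S.card : ℝ) ≤ ∑ ib : Fin 3 × Bool, ((normalPatch w S ib.1 ib.2).card : ℝ) := by
        exact_mod_cast hle
    _ ≤ ∑ _ib : Fin 3 × Bool, 400 * (w + 1) / ε ^ 2 :=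
        Finset.sum_le_sum fun ib _ => card_normalPatch_le hw hε hε3 hS hsep ib.1 ib.2
    _ = 2400 * (w + 1) / ε ^ 2 := by
        rw [Finset.sum_const, Finset.card_univ, Fintype.card_prod, Fintype.card_fin,
          Fintype.card_bool, nsmul_eq_mul]
        push_cast
        ring

/-- Every separated subset of the capsule extends to a net. -/
theorem exists_net_superset {w ε : ℝ} (hw : 0 ≤ w) (hε : 0 < ε) (hε3 : ε ≤ 3) {T : Finset E3}
    (hT : ∀ p ∈ T, p ∈ capsule w) (hsep : ∀ p ∈ T, ∀ q ∈ T, p ≠ q → ε / 2 ≤ dist p q) :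
    ∃ S, T ⊆ S ∧ IsCapsuleNet w ε S := by
  classical
  -- A separated superset of the largest possible cardinality is a net.
  let N : Set ℕ := {k | ∃ S : Finset E3, T ⊆ S ∧ (∀ p ∈ S, p ∈ capsule w) ∧
    (∀ p ∈ S, ∀ q ∈ S, p ≠ q → ε / 2 ≤ dist p q) ∧ S.card = k}
  have hN : N.Nonempty := ⟨_, T, subset_rfl, hT, hsep, rfl⟩
  have hb : BddAbove N := by
    refine ⟨⌊2400 * (w + 1) / ε ^ 2⌋₊, ?_⟩
    rintro _ ⟨S, -, h1, h2, rfl⟩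
    exact Nat.le_floor (card_le_of_separated hw hε hε3 h1 h2)
  obtain ⟨S, hTS, h1, h2, hcard⟩ := Nat.sSup_mem hN hb
  refine ⟨S, hTS, h1, h2, fun x hx => ?_⟩
  by_contra! hfar
  have hxS : x ∉ S := fun h => by
    have := hfar x h
    rw [dist_self] at this
    linarith
  have hmem : S.card + 1 ∈ N := by
    refine ⟨insert x S, hTS.trans (Finset.subset_insert _ _), ?_, ?_,
      Finset.card_insert_of_notMem hxS⟩
    · intro p hp
      rcases Finset.mem_insert.1 hp with rfl | hp
      · exact hx
      · exact h1 p hp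
    · intro p hp q hq hne
      rcases Finset.mem_insert.1 hp with rfl | hp' <;> rcases Finset.mem_insert.1 hq with rfl | hq'
      · exact absurd rfl hne
      · exact (hfar q hq').le
      · rw [dist_comm]
        exact (hfar p hp').le
      · exact h2 p hp' q hq' hne
  have := le_csSup hb hmem
  omega

/-! ### Rows of points on the seam -/

open Classical in
/-- The first `k` points at spacing `h` on the seam, from its left end on. -/
noncomputable def seamRow (w h : ℝ) (k : ℕ) : Finset E3 :=
  (Finset.range k).image fun i : ℕ => (!₂[-w + i * h, 0, -1] : E3)

theorem mem_seamRow {w h : ℝ} {k : ℕ} {p : E3} :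
    p ∈ seamRow w h k ↔ ∃ i < k, (!₂[-w + i * h, 0, -1] : E3) = p := by
  simp [seamRow]

theorem le_dist_row {w h : ℝ} {i j : ℕ} (hij : i ≠ j) :
    h ≤ dist (!₂[-w + i * h, 0, -1] : E3) !₂[-w + j * h, 0, -1] := by
  apply E3.le_dist
  change h ^ 2 ≤ (-w + i * h - (-w + j * h)) ^ 2 + (0 - 0) ^ 2 + (-1 - -1) ^ 2
  have h1 : (1 : ℝ) ≤ ((i : ℝ) - j) ^ 2 := by
    have : (1 : ℤ) ≤ ((i : ℤ) - j) ^ 2 := by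
      have : ((i : ℤ) - j) ≠ 0 := by omega
      have := sq_pos_of_ne_zero this
      omega
    exact_mod_cast this
  nlinarith [mul_le_mul_of_nonneg_right h1 (sq_nonneg h)]

theorem seamRow_separated (w h : ℝ) (k : ℕ) :
    ∀ p ∈ seamRow w h k, ∀ q ∈ seamRow w h k, p ≠ q → h ≤ dist p q := by
  intro p hp q hq hne
  obtain ⟨i, -, rfl⟩ := mem_seamRow.1 hp
  obtain ⟨j, -, rfl⟩ := mem_seamRow.1 hq
  exact le_dist_row fun h => hne (by rw [h])

theorem card_seamRow {w h : ℝ} (hh : 0 < h) (k : ℕ) : (seamRow w h k).card = k := by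
  rw [seamRow, Finset.card_image_of_injective, Finset.card_range]
  intro i j hij
  by_contra hne
  have := le_dist_row (w := w) (h := h) hne
  simp only at hij
  rw [hij, dist_self] at this
  linarith

theorem seamRow_subset_capsule {w h : ℝ} (hh : 0 < h) {k : ℕ} (hk : k * h ≤ 2 * w + h) :
    ∀ p ∈ seamRow w h k, p ∈ capsule w := by
  intro p hp
  obtain ⟨i, hi, rfl⟩ := mem_seamRow.1 hp
  have h1 : (i : ℝ) + 1 ≤ k := by exact_mod_cast hi
  have h2 : 0 ≤ (i : ℝ) * h := mul_nonneg (Nat.cast_nonneg i) hh.le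
  apply neg_e2_mem_capsule
  · linarith
  · nlinarith

theorem le_card_seam_of_seamRow_subset {w h : ℝ} (hh : 0 < h) {k : ℕ} {S : Finset E3}
    (hS : seamRow w h k ⊆ S) : k ≤ (seam S).card := by
  conv_lhs => rw [← card_seamRow (w := w) hh k]
  refine Finset.card_le_card fun p hp => mem_seam.2 ⟨hS hp, ?_⟩
  obtain ⟨i, -, rfl⟩ := mem_seamRow.1 hp
  rfl

/-- For `ε < 2√2`: pairs of samples of the same capsule with `N` and `N + 1` points, `m` of them on
the seam, exist as soon as `N` exceeds the packing bound for a capsule of length `m ε / 2`. -/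
theorem exists_samples_of_small {ε : ℝ} (hε : 0 < ε) (hε8 : ε ^ 2 < 8) {m N : ℕ} (hm : 0 < m)
    (hN : 2400 * (m * ε / 4 + 1) / ε ^ 2 ≤ N) :
    ∃ w > (0 : ℝ), ∃ S₀ S₁ : Finset E3, IsCapsuleSample w ε S₀ ∧ IsCapsuleSample w ε S₁ ∧
      S₀.card = N ∧ S₁.card = N + 1 ∧ m ≤ (seam S₀).card ∧ m ≤ (seam S₁).card := by
  have hm' : (0 : ℝ) < m := by exact_mod_cast hm
  have hε3 : ε ≤ 3 := by nlinarith
  have hh : 0 < ε / 2 := by linarith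
  have hw : 0 < m * ε / 4 := by positivity
  obtain ⟨S, hrow, hS⟩ := exists_net_superset (T := seamRow (m * ε / 4) (ε / 2) m) hw.le hε hε3
    (seamRow_subset_capsule hh (by linarith)) (seamRow_separated _ _ m)
  have hcard : S.card ≤ N := by
    exact_mod_cast (card_le_of_separated hw.le hε hε3 hS.1 hS.2.1).trans hN
  have hmS := le_card_seam_of_seamRow_subset hh hrow
  obtain ⟨w, hw', S₀, S₁, h0, h1, c0, c1, m0, m1⟩ := hS.exists_card hw hε hcard
  exact ⟨w, hw', S₀, S₁, h0.isCapsuleSample hw'.le hε hε8, h1.isCapsuleSample hw'.le hε hε8, c0, c1,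
    hmS.trans m0, hmS.trans m1⟩

theorem exists_grid_cell {k : ℕ} (hk : 0 < k) {h v : ℝ} (hv0 : 0 ≤ v)
    (hv : v ≤ k * h) : ∃ i < k, (i : ℝ) * h ≤ v ∧ v ≤ (i + 1) * h := by
  induction k, hk using Nat.le_induction with
  | base => exact ⟨0, one_pos, by simpa using hv0, by simpa using hv⟩
  | succ k hk ih =>
    rcases le_total v (k * h) with hle | hle
    · obtain ⟨i, hi, h1, h2⟩ := ih hle
      exact ⟨i, hi.trans (Nat.lt_succ_self k), h1, h2⟩
    · exact ⟨k, Nat.lt_succ_self k, hle, by exact_mod_cast hv⟩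

/-- For `ε ≥ 2√2` a single row of points on the seam, at a spacing slightly above `ε / 2`, is a
sample of the whole capsule. -/
theorem isCapsuleSample_seamRow {w h ε : ℝ} {k : ℕ} (hw : 0 < w) (hε : 0 < ε) (hε8 : 8 ≤ ε ^ 2)
    (hk : 0 < k) (hkh : k * h = 2 * w) (hh : ε / 2 ≤ h) (hh2 : h ^ 2 ≤ 13 / 50 * ε ^ 2) :
    IsCapsuleSample w ε (seamRow w h (k + 1)) := by
  have hh0 : 0 < h := by linarith
  refine ⟨seamRow_subset_capsule hh0 (by push_cast; linarith),
    fun p hp q hq hne => hh.trans (seamRow_separated _ _ _ p hp q hq hne), fun x hx => ?_⟩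
  -- Both ends of a grid interval that holds the projection of `x` to the axis are within `ε`.
  have hu1 := neg_le_clamp w (x 0)
  have hu2 := clamp_le hw.le (x 0)
  obtain ⟨u, hu⟩ : ∃ u, u = max (-w) (min (x 0) w) := ⟨_, rfl⟩
  rw [← hu] at hu1 hu2
  obtain ⟨i, hi, h1, h2⟩ := exists_grid_cell hk (h := h) (v := u + w) (by linarith) (by linarith)
  have hx1 := mem_capsule.1 hx
  obtain ⟨s, hs⟩ : ∃ s, s = shrink w (x 0) := ⟨_, rfl⟩
  have hx0 : x 0 = u + s := by rw [hs, hu, shrink]; ring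
  rw [← hs] at hx1
  have hbound : 2 * x 2 + 2 * (|s| * h) ≤ ε ^ 2 - h ^ 2 - 2 := by
    refine abs_le_of_sq_le_sq' ?_ (by linarith) |>.2
    -- The Cauchy–Schwarz inequality, with `x 2 ^ 2 + s ^ 2 ≤ 1`.
    have k1 : (2 * x 2 + 2 * (|s| * h)) ^ 2 ≤ 4 * ((x 2 ^ 2 + s ^ 2) * (1 + h ^ 2)) := by
      rw [← sq_abs s]
      nlinarith [sq_nonneg (x 2 * h - |s|)]
    have k2 : (x 2 ^ 2 + s ^ 2) * (1 + h ^ 2) ≤ 1 * (1 + h ^ 2) :=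
      mul_le_mul_of_nonneg_right (by linarith [sq_nonneg (x 1)]) (by positivity)
    have k3 : 37 / 50 * ε ^ 2 - 2 ≤ ε ^ 2 - h ^ 2 - 2 := by linarith
    have k4 : (37 / 50 * ε ^ 2 - 2) ^ 2 ≤ (ε ^ 2 - h ^ 2 - 2) ^ 2 :=
      pow_le_pow_left₀ (by linarith) k3 2
    nlinarith
  have hnear : ∀ j : ℕ, |u - (-w + j * h)| ≤ h →
      dist x (!₂[-w + j * h, 0, -1] : E3) ≤ ε := by
    intro j hj
    refine E3.dist_le hε.le ?_
    change (x 0 - (-w + j * h)) ^ 2 + (x 1 - 0) ^ 2 + (x 2 - -1) ^ 2 ≤ ε ^ 2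
    obtain ⟨δ, hδ⟩ : ∃ δ, δ = u - (-w + j * h) := ⟨_, rfl⟩
    rw [← hδ] at hj
    have e : x 0 - (-w + j * h) = s + δ := by rw [hx0, hδ]; ring
    rw [e]
    have k1 : s * δ ≤ |s| * h :=
      (le_abs_self _).trans ((abs_mul s δ).trans_le (mul_le_mul_of_nonneg_left hj (abs_nonneg s)))
    have k2 : δ ^ 2 ≤ h ^ 2 := sq_le_sq' (abs_le.1 hj).1 (abs_le.1 hj).2
    nlinarith
  have n1 := hnear i (abs_le.2 ⟨by linarith, by linarith⟩)
  have n2 := hnear (i + 1) (by push_cast; exact abs_le.2 ⟨by linarith, by linarith⟩)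
  refine ⟨_, mem_seamRow.2 ⟨i, by omega, rfl⟩, _, mem_seamRow.2 ⟨i + 1, by omega, rfl⟩,
    fun heq => ?_, n1, n2⟩
  have := le_dist_row (w := w) (h := h) (i := i) (j := i + 1) (by omega)
  rw [heq, dist_self] at this
  linarith

/-- For `ε ≥ 2√2`: samples of the same capsule with `N` and `N + 1` points, all on the seam. -/
theorem exists_samples_of_large {ε : ℝ} (hε : 0 < ε) (hε8 : 8 ≤ ε ^ 2) {N : ℕ} (hN : 100 ≤ N) :
    ∃ w > (0 : ℝ), ∃ S₀ S₁ : Finset E3, IsCapsuleSample w ε S₀ ∧ IsCapsuleSample w ε S₁ ∧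
      S₀.card = N ∧ S₁.card = N + 1 ∧ N ≤ (seam S₀).card ∧ N ≤ (seam S₁).card := by
  obtain ⟨k, rfl⟩ : ∃ k, N = k + 1 := ⟨N - 1, by omega⟩
  have hk : (99 : ℝ) ≤ k := by exact_mod_cast (by omega : 99 ≤ k)
  have hk0 : (0 : ℝ) < k := by linarith
  have hw : 0 < (k + 1) * ε / 4 := by positivity
  have hh : 0 < ε / 2 := by linarith
  have hle : ε / 2 ≤ (k + 1) * ε / (2 * k) := by
    rw [div_le_div_iff₀ (by norm_num) (by positivity)]
    nlinarith
  have hsq : ((k + 1) * ε / (2 * k)) ^ 2 ≤ 13 / 50 * ε ^ 2 := by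
    have h1 : (k + 1) * ε / (2 * k) ≤ 100 / 99 * (ε / 2) := by
      rw [div_le_iff₀ (by positivity)]
      nlinarith
    have h2 := pow_le_pow_left₀ (by positivity) h1 2
    nlinarith
  have hh' : 0 < (k + 1) * ε / (2 * k) := by positivity
  -- With `N = k + 1`, the spacings divide the axis of length `(k + 1) * ε / 2` into `k` and `k + 1`
  -- intervals.
  refine ⟨(k + 1) * ε / 4, hw, seamRow _ ((k + 1) * ε / (2 * k)) (k + 1),
    seamRow _ (ε / 2) (k + 1 + 1),
    isCapsuleSample_seamRow hw hε hε8 (by omega) (by field_simp; norm_num) hle hsq,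
    isCapsuleSample_seamRow hw hε hε8 (by omega) (by push_cast; ring) le_rfl (by nlinarith),
    card_seamRow hh' _, card_seamRow hh _, ?_, ?_⟩
  · exact le_card_seam_of_seamRow_subset hh' subset_rfl
  · exact (Nat.le_succ _).trans (le_card_seam_of_seamRow_subset hh subset_rfl)

/-! ### Counting -/

/-- The two ranges of `ε` combined. The hypothesis `hC` makes `n` large enough for the packing bound
to leave room for about `n * ε / 2400` points on the seam. -/
theorem exists_samples {K ε : ℝ} {n : ℕ} (hK : 1 ≤ K) (hn : 0 < n) (hε : 0 < ε) (hεK : ε ≤ K)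
    (hC : (4800 + 20 * K) ^ 2 < n * ε ^ 2) :
    ∃ w > (0 : ℝ), ∃ S₀ S₁ : Finset E3, IsCapsuleSample w ε S₀ ∧ IsCapsuleSample w ε S₁ ∧
      S₀.card = n / 2 ∧ S₁.card = n / 2 + 1 ∧
      n * ε / (4800 * K) ≤ (seam S₀).card ∧ n * ε / (4800 * K) ≤ (seam S₁).card := by
  have hn0 : (0 : ℝ) < n := by exact_mod_cast hn
  have hn1 : (1 : ℝ) ≤ n := by exact_mod_cast hn
  have hε2 : 0 < ε ^ 2 := by positivity
  have hεK2 : ε ^ 2 ≤ K ^ 2 := pow_le_pow_left₀ hε.le hεK 2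
  have hn400 : (400 : ℝ) < n := by
    by_contra! h
    nlinarith
  have hn400' : 400 < n := by exact_mod_cast hn400
  have hhalf : (n : ℝ) ≤ 2 * ((n / 2 : ℕ) : ℝ) + 1 := by
    exact_mod_cast (by omega : n ≤ 2 * (n / 2) + 1)
  rcases lt_or_ge (ε ^ 2) 8 with h8 | h8
  · have hnε : 2400 ≤ n * ε := by
      refine abs_le_of_sq_le_sq' (a := 2400) ?_ (by positivity) |>.2
      nlinarith [mul_le_mul_of_nonneg_right hn1 (mul_pos hn0 hε2).le]
    have hq : 1 ≤ n * ε / 2400 := by rw [one_le_div (by norm_num)]; exact hnε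
    have hm0 : 0 < ⌊n * ε / 2400⌋₊ := Nat.floor_pos.2 hq
    have hm1 : (⌊n * ε / 2400⌋₊ : ℝ) ≤ n * ε / 2400 := Nat.floor_le (by positivity)
    have hm2 := Nat.lt_floor_add_one (n * ε / 2400)
    have hm3 : (1 : ℝ) ≤ ⌊n * ε / 2400⌋₊ := by exact_mod_cast hm0
    have hN : 2400 * (⌊n * ε / 2400⌋₊ * ε / 4 + 1) / ε ^ 2 ≤ ((n / 2 : ℕ) : ℝ) := by
      rw [div_le_iff₀ hε2]
      -- The two terms of the packing bound are at most `n / 4` and `n / 8`.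
      have h1 : (⌊n * ε / 2400⌋₊ : ℝ) * ε ≤ n * ε / 2400 * ε :=
        mul_le_mul_of_nonneg_right hm1 hε.le
      have h2 : 3 / 8 * (n : ℝ) ≤ ((n / 2 : ℕ) : ℝ) := by linarith
      have h3 := mul_le_mul_of_nonneg_right h2 hε2.le
      nlinarith
    have hm4 : n * ε / (4800 * K) ≤ (⌊n * ε / 2400⌋₊ : ℝ) := by
      rw [div_le_iff₀ (by positivity)]
      nlinarith
    obtain ⟨w, hw, S₀, S₁, h0, h1, c0, c1, m0, m1⟩ := exists_samples_of_small hε h8 hm0 hN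
    exact ⟨w, hw, S₀, S₁, h0, h1, c0, c1, hm4.trans (by exact_mod_cast m0),
      hm4.trans (by exact_mod_cast m1)⟩
  · have hm4 : n * ε / (4800 * K) ≤ ((n / 2 : ℕ) : ℝ) := by
      rw [div_le_iff₀ (by positivity)]
      nlinarith [mul_le_mul_of_nonneg_left hεK hn0.le]
    obtain ⟨w, hw, S₀, S₁, h0, h1, c0, c1, m0, m1⟩ :=
      exists_samples_of_large hε h8 (N := n / 2) (by omega)
    exact ⟨w, hw, S₀, S₁, h0, h1, c0, c1, hm4.trans (by exact_mod_cast m0),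
      hm4.trans (by exact_mod_cast m1)⟩

theorem mainTheorem12 (E : ℝ) :
    ∃ C > (0 : ℝ), ∃ c > (0 : ℝ), ∀ (n : ℕ) (ε : ℝ), 0 < n →
      C * Real.sqrt (1 / (n : ℝ)) < ε → ε ≤ E →
      ∃ w > (0 : ℝ), ∃ d > (0 : ℝ),
        IsC11Surface (sausageSurface w d) ∧
        Nat.card (ConnectedComponents (sausageSurface w d)) = 2 ∧
        ∃ S : Finset E3,
          S.card = n ∧
          IsUniformSample (sausageSurface w d) ε S ∧
          c * ((n : ℝ) ^ 2 * ε ^ 2) ≤ (Nat.card (delaunayGraph S).edgeSet : ℝ) ∧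
          c * ((n : ℝ) ^ 2 * ε ^ 2) ≤ (Nat.card (strictDelaunayGraph S).edgeSet : ℝ) := by
  obtain ⟨K, hK⟩ : ∃ K, K = |E| + 1 := ⟨_, rfl⟩
  have hK1 : 1 ≤ K := by linarith [abs_nonneg E]
  have hKE : E ≤ K := by linarith [le_abs_self E]
  refine ⟨4800 + 20 * K, by linarith, (1 / (4800 * K)) ^ 2, by positivity, ?_⟩
  intro n ε hn hCε hεE
  have hn0 : (0 : ℝ) < n := by exact_mod_cast hn
  have hε : 0 < ε := lt_of_le_of_lt (by positivity) hCε
  have hC : (4800 + 20 * K) ^ 2 < n * ε ^ 2 := by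
    have h1 := pow_lt_pow_left₀ hCε (by positivity) two_ne_zero
    rw [mul_pow, Real.sq_sqrt (by positivity), mul_one_div, div_lt_iff₀ hn0] at h1
    linarith
  obtain ⟨w, hw, S₀, S₁, h0, h1, c0, c1, m0, m1⟩ :=
    exists_samples hK1 hn hε (hεE.trans hKE) hC
  have hm : 0 ≤ n * ε / (4800 * K) := by positivity
  have hsq : (1 / (4800 * K)) ^ 2 * ((n : ℝ) ^ 2 * ε ^ 2) = (n * ε / (4800 * K)) ^ 2 := by
    field_simp
  rw [hsq]
  rcases Nat.even_or_odd n with hpar | hpar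
  · obtain ⟨d, hd, hsurf, hcomp, S, hS, hrest⟩ := exists_sausageSurface_sample hw hε h0 h0 hm m0 m0
    have := Nat.even_iff.1 hpar
    exact ⟨w, hw, d, hd, hsurf, hcomp, S, by omega, hrest⟩
  · obtain ⟨d, hd, hsurf, hcomp, S, hS, hrest⟩ := exists_sausageSurface_sample hw hε h0 h1 hm m0 m1
    have := Nat.odd_iff.1 hpar
    exact ⟨w, hw, d, hd, hsurf, hcomp, S, by omega, hrest⟩
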